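/- For each $n\ge 1$ let $\mathbf Y=\mathbf X\boldsymbol\beta^0+\sigma\boldsymbol\epsilon$ with $\boldsymbol\epsilon\sim\mathcal N(0,I_n)$, where $\mathbf X=(X_{ij})$ is a deterministic $n\times p_n$ design matrix, $\boldsymbol\beta^0\in\mathbb R^{p_n}$ is the true coefficient vector, $s=\|\boldsymbol\beta^0\|_0$ is its number of nonzero entries ($\mathbf X,\boldsymbol\beta^0,s$ may depend on $n$), and $\sigma>0$ is known and fixed. Write $a_n\prec b_n$ for $a_n=o(b_n)$ and $a\vee b=\max(a,b)$. Assume, for all large $n$ where a condition concerns a single $n$: 1. $\sum_i X_{ij}^2\le n$ for every column $j$. 2. There are integers $\overline p$ (depending on $n$) with $s\prec\overline p$ and a fixed $\lambda_0>0$ such that, for every $\xi\subseteq\{1,\dots,p_n\}$ with $|\xi|\le\overline p$, all eigenvalues of $\mathbf X_\xi^T\mathbf X_\xi$ are greater than $n\lambda_0$, where $\mathbf X_\xi$ consists of the columns of $\mathbf X$ with index in $\xi$. 3. There is a constant $C$ with $\log|\beta^0_j|\le C\log(p_n\vee n)$ for all $j$ with $\beta^0_j\ne0$. 4. The prior $\pi$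 makes $\beta_1,\dots,\beta_{p_n}$ independent with $\beta_j\mid\lambda_j\sim\mathcal N(0,\lambda_j^{-1})$, $\lambda_j\sim\mathrm{Gamma}(a_0,b_n)$ (shape, rate), where $a_0>1$ is fixed, $b_n>0$, and for some constants $K$ and $\delta>0$ $$(p_n\vee n)^{-K}\prec \frac{b_n}{a_0}\prec\frac{s\log(p_n\vee n)}{n\,p_n^{2+1/a_0}(p_n\vee n)^{\delta/a_0}}.$$ Let $\mathcal Q$ be the family of laws on $\mathbb R^{p_n}$ under which the coordinates are independent with $\beta_j\mid\lambda_j\sim\mathcal N(\mu_j,\lambda_j^{-1})$, $\lambda_j\sim\mathrm{Gamma}(a_j,b_j)$, for arbitrary $\mu_j\in\mathbb R$, $a_j>0$, $b_j>0$, and let $$\Omega(q)=-\mathbb E_{q}[\log p(\mathbf Y\mid\boldsymbol\beta)]+\mathrm{KL}(q\,\|\,\pi)\in(-\infty,+\infty]$$ be the negative ELBO, where $p(\cdot\mid\boldsymbol\beta)$ is the density of $\mathcal N(\mathbf X\boldsymbol\beta,\sigma^2I_n)$. Fix $\kappa\ge0$, and call $\widehat q\in\mathcal Q$ a variational posterior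 with slack $\kappa$ if $\Omega(\widehat q)\le\Omega(q)+\kappa\, s\log(p_n\vee n)$ for all $q\in\mathcal Q$; for $\kappa=0$ this says that $\widehat q$ is a minimiser of $\Omega$ over $\mathcal Q$, that is, the variational posterior. Then there are events $E_n$ (measurable sets of values of $\mathbf Y$) with $P_{\boldsymbol\beta^0}(\mathbf Y\in E_n)\to1$ such that, for every sequence $M_n'\to\infty$, $$\sup_{\mathbf Y\in E_n}\ \sup_{\widehat q}\ \widehat q\Bigl(\|\boldsymbol\beta-\boldsymbol\beta^0\|_2\ge M_n'\sqrt{s\log(p_n\vee n)/n}\Bigr)\longrightarrow 0\qquad(n\to\infty),$$ where the inner supremum is over all variational posteriors $\widehat q$ with slack $\kappa$ for the data $\mathbf Y$ (a supremum over the empty set being $0$). In particular, the VB posterior contracts at the nearly optimal rate $\sqrt{s\log(p_n\vee n)/n}$. -/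

import Mathlib

open MeasureTheory ProbabilityTheory Filter Asymptotics Topology
open scoped Matrix ENNReal NNReal

noncomputable section

/-- The location-scale Student-`t` law on `ℝ` as a scale mixture of Gaussians:
`x | l ∼ N(m, l⁻¹)` with precision `l ∼ Gamma(a, b)` (shape `a`, rate `b`).
It has `2a` degrees of freedom, location `m` and scale `√(b / a)`. -/
def studentT (m a b : ℝ) : Measure ℝ :=
  (gammaMeasure a b).bind fun l => gaussianReal m (Real.toNNReal l⁻¹)

/-- The mixture is well defined: for positive shape and rate it is a probability measure. -/
theorem isProbabilityMeasure_studentT {a b : ℝ} (ha : 0 < a) (hb : 0 < b) (m : ℝ) :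
    IsProbabilityMeasure (studentT m a b) := by
  have h1 := isProbabilityMeasure_gammaMeasure ha hb
  have hm : Measurable fun l : ℝ => gaussianReal m (Real.toNNReal l⁻¹) :=
    measurable_gaussianReal.comp
      (measurable_const.prodMk (measurable_inv.real_toNNReal))
  constructor
  rw [studentT, Measure.bind_apply MeasurableSet.univ hm.aemeasurable]
  simp

/-- The prior on `ℝᵖ`: independent centred Student-`t` coordinates,
each with hyperparameters `a₀` and `b`. -/
def studentPrior (p : ℕ) (a₀ b : ℝ) : Measure (Fin p → ℝ) :=
  Measure.pi fun _ => studentT 0 a₀ b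

/-- The variational family: products of Student-`t` laws with free parameters
`m j ∈ ℝ`, `a j > 0`, `b j > 0`. -/
def variationalFamily (p : ℕ) : Set (Measure (Fin p → ℝ)) :=
  {q | ∃ m a b : Fin p → ℝ, (∀ j, 0 < a j) ∧ (∀ j, 0 < b j) ∧
    q = Measure.pi fun j => studentT (m j) (a j) (b j)}

/-- The law of `Y = X β + σ ε` with `ε ∼ N(0, Iₙ)`. -/
def dataLaw {n p : ℕ} (X : Matrix (Fin n) (Fin p) ℝ) (σ : ℝ) (β : Fin p → ℝ) :
    Measure (Fin n → ℝ) :=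
  (Measure.pi fun _ : Fin n => gaussianReal 0 1).map fun ε => X *ᵥ β + σ • ε

/-- The likelihood `p(y | β)`: the density of `N(X β, σ² Iₙ)` at `y`. -/
def likelihood {n p : ℕ} (X : Matrix (Fin n) (Fin p) ℝ) (σ : ℝ) (y : Fin n → ℝ)
    (β : Fin p → ℝ) : ℝ :=
  ∏ i, gaussianPDFReal ((X *ᵥ β) i) (Real.toNNReal (σ ^ 2)) (y i)

/-- The expectation of `f` under `q` as an extended real: positive part minus negative part.
It is `+∞` if the positive part is not integrable while the negative part is. -/
def extExpectation {α : Type*} [MeasurableSpace α] (q : Measure α) (f : α → ℝ) : EReal :=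
  ((∫⁻ x, ENNReal.ofReal (f x) ∂q : ℝ≥0∞) : EReal)
    - ((∫⁻ x, ENNReal.ofReal (-f x) ∂q : ℝ≥0∞) : EReal)

/-- The negative ELBO
`Ω(q) = -E_q[log p(y | β)] + KL(q ‖ π)`, with values in `(-∞, +∞]`
(minus the log-likelihood is bounded below in `β`). -/
def negELBO {n p : ℕ} (X : Matrix (Fin n) (Fin p) ℝ) (σ a₀ b : ℝ) (y : Fin n → ℝ)
    (q : Measure (Fin p → ℝ)) : EReal :=
  extExpectation q (fun β => -Real.log (likelihood X σ y β))
    + ((InformationTheory.klDiv q (studentPrior p a₀ b) : ℝ≥0∞) : EReal)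

/-- `q` minimises the negative ELBO over the variational family up to the slack `η`;
for `η = 0` it is a minimiser, that is, a variational posterior. -/
def IsVariationalPosterior {n p : ℕ} (X : Matrix (Fin n) (Fin p) ℝ) (σ a₀ b : ℝ)
    (y : Fin n → ℝ) (η : ℝ) (q : Measure (Fin p → ℝ)) : Prop :=
  q ∈ variationalFamily p ∧
    ∀ q' ∈ variationalFamily p, negELBO X σ a₀ b y q ≤ negELBO X σ a₀ b y q' + (η : EReal)

/-- The number `‖β‖₀` of nonzero entries of `β`. -/
def sparsity {p : ℕ} (β : Fin p → ℝ) : ℕ :=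
  (Finset.univ.filter fun j => β j ≠ 0).card

/-- The columns `X_ξ` of `X` with index in `ξ`. -/
def columnSubmatrix {n p : ℕ} (X : Matrix (Fin n) (Fin p) ℝ) (ξ : Finset (Fin p)) :
    Matrix (Fin n) ξ ℝ :=
  X.submatrix id (fun j => (j : Fin p))

/-- `log (p ∨ n)`. -/
def logMax (p n : ℕ) : ℝ := Real.log ((max p n : ℕ) : ℝ)

/-- The rate `√(s log (p ∨ n) / n)`. -/
def contractionRate (s p n : ℕ) : ℝ := Real.sqrt ((s : ℝ) * logMax p n / (n : ℝ))

end

/-! The proof rests on the Donsker–Varadhan inequality with one well-chosen test function. Write `L`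
for `log (p ∨ n)`, `v` for `σ⁻¹ X (β - β₀)`, `e` for the standardised noise, and `k` for the number
of coordinates of `β` exceeding `r = √(s L / n) / p` in absolute value. Up to a term free of `β`,
the negative log-likelihood is `|v|² / 2 - v · e`.

The test function is `g = δ L k + w · e - |w|² / 2`, where `w = (1 - θ) v` if `k + s ≤ pbar` and `w
= v` otherwise. For fixed `β`, `exp (w · e - |w|² / 2)` has mean one under the noise, so by Fubini
the noise average of `∫ exp g dπ` is `∫ exp (δ L k) dπ`. This is at most `exp 1`, because the upper
bound on `b` leaves each prior coordinate mass at most `exp (-δ L) / p` beyond `r`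
(`studentT_tail_le_of_rate_bound`, `lintegral_exp_largeCount_le`). By Markov, `log ∫ exp g dπ ≤ s L`
with high probability. On that event Donsker–Varadhan gives `E_q g ≤ KL + s L`; adding the expected
negative log-likelihood bounds `E_q [g + |v|² / 2 - v · e]` by `Ω(q) - baseline + s L`
(`measure_ge_le_of_negELBO_le`).

This integrand is coercive. If `k + s ≤ pbar`, the shrinkage leaves a multiple of `|v|²` and only `θ
v · e` of the noise. Restricted eigenvalues on the active set give `v · e ≤ |v|² / 4 + C (k + s) L`
(`cross_term_le`), and for small `θ` half of the penalty `δ L k` pays for the part in `k`. If `k + s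
> pbar`, the likelihood terms cancel and the penalty remains.

An upper bound on `Ω(q)` comes from the prior translated to `β₀`
(`negELBO_shifted_studentPrior_le`): its density with respect to the prior is bounded, only the
support of `β₀` costs entropy, `O(L)` per coordinate, and its variance adds `O(s L)`. Markov under
`q` then gives `k = O(s)` and `|v|² = O(s L)` off a set of small mass, and restricted eigenvalues
turn this into the `ℓ₂` rate (`measure_norm_ge_le`). The noise event involves neither `M` nor `ε`,
which gives the uniformity. -/

/-! ### Student laws: density, variance, tails and translates. -/

/-- Moments of exponentially tilted Gamma laws. -/
theorem lintegral_rpow_mul_exp_gammaMeasure {a b c d : ℝ} (ha : 0 < a) (hb : 0 < b)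
    (hc : 0 < a + c) (hd : 0 < b + d) :
    ∫⁻ l, ENNReal.ofReal (l ^ c * Real.exp (-(d * l))) ∂(gammaMeasure a b)
      = ENNReal.ofReal (b ^ a / Real.Gamma a * (Real.Gamma (a + c) / (b + d) ^ (a + c))) := by
  have hm : Measurable (gammaPDF a b) := (measurable_gammaPDFReal a b).ennreal_ofReal
  rw [gammaMeasure, lintegral_withDensity_eq_lintegral_mul _ hm (by fun_prop)]
  have hG : 0 < Real.Gamma a := Real.Gamma_pos_of_pos ha
  have hG' : 0 < Real.Gamma (a + c) := Real.Gamma_pos_of_pos hc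
  have key : ∀ᵐ l : ℝ, (gammaPDF a b * fun l => ENNReal.ofReal (l ^ c * Real.exp (-(d * l)))) l
      = ENNReal.ofReal (b ^ a / Real.Gamma a * (Real.Gamma (a + c) / (b + d) ^ (a + c)))
        * gammaPDF (a + c) (b + d) l := by
    have h0 : ∀ᵐ l : ℝ, l ≠ 0 := by simp [ae_iff]
    filter_upwards [h0] with l hl0
    rcases lt_or_gt_of_ne hl0 with hl | hl
    · simp [gammaPDF_of_neg hl]
    · rw [Pi.mul_apply, gammaPDF_of_nonneg hl.le, gammaPDF_of_nonneg hl.le,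
        ← ENNReal.ofReal_mul (by positivity), ← ENNReal.ofReal_mul (by positivity)]
      congr 1
      have e1 : l ^ (a + c - 1) = l ^ (a - 1) * l ^ c := by
        rw [← Real.rpow_add hl]; ring_nf
      have e2 : Real.exp (-((b + d) * l)) = Real.exp (-(b * l)) * Real.exp (-(d * l)) := by
        rw [← Real.exp_add]; ring_nf
      have : 0 < (b + d) ^ (a + c) := by positivity
      rw [e1, e2]
      field_simp
  have hm' : Measurable (gammaPDF (a + c) (b + d)) :=
    (measurable_gammaPDFReal _ _).ennreal_ofReal
  rw [lintegral_congr_ae key, lintegral_const_mul _ hm', lintegral_gammaPDF_eq_one hc hd, mul_one]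

/-- This discards `l ≤ 0`, where the truncated variance `Real.toNNReal l⁻¹` is zero and the Gaussian
degenerates to a point mass. -/
theorem ae_pos_gammaMeasure (a b : ℝ) : ∀ᵐ l ∂(gammaMeasure a b), 0 < l := by
  have hm : Measurable (gammaPDF a b) := (measurable_gammaPDFReal a b).ennreal_ofReal
  have h0 : ∀ᵐ l : ℝ, l ≠ 0 := by simp [ae_iff]
  rw [gammaMeasure, ae_withDensity_iff hm]
  filter_upwards [h0] with l hl0 hl
  rcases lt_or_gt_of_ne hl0 with h | h
  · exact absurd (gammaPDF_of_neg h) hl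
  · exact h

theorem measurable_gaussianReal_precision (m : ℝ) :
    Measurable fun l : ℝ => gaussianReal m (Real.toNNReal l⁻¹) :=
  measurable_gaussianReal.comp (measurable_const.prodMk (measurable_inv.real_toNNReal))

theorem lintegral_studentT (m a b : ℝ) {f : ℝ → ℝ≥0∞} (hf : Measurable f) :
    ∫⁻ x, f x ∂(studentT m a b)
      = ∫⁻ l, ∫⁻ x, f x ∂(gaussianReal m (Real.toNNReal l⁻¹)) ∂(gammaMeasure a b) :=
  Measure.lintegral_bind (measurable_gaussianReal_precision m).aemeasurable hf.aemeasurable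

/-- The normalising constant of the Student density. -/
noncomputable def studentConst (a b : ℝ) : ℝ :=
  (√(2 * Real.pi))⁻¹ * (b ^ a / Real.Gamma a * Real.Gamma (a + 1 / 2))

/-- The density of `studentT m a b`. -/
noncomputable def studentPDFReal (m a b x : ℝ) : ℝ :=
  studentConst a b / (b + (x - m) ^ 2 / 2) ^ (a + 1 / 2)

theorem studentConst_pos {a b : ℝ} (ha : 0 < a) (hb : 0 < b) : 0 < studentConst a b := by
  have := Real.Gamma_pos_of_pos ha
  have : 0 < Real.Gamma (a + 1 / 2) := Real.Gamma_pos_of_pos (by linarith)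
  unfold studentConst
  positivity

theorem measurable_studentPDFReal (m a b : ℝ) : Measurable (studentPDFReal m a b) := by
  unfold studentPDFReal; fun_prop

/-- As a function of the precision `l`, a Gaussian density is a constant times `l ^ (1/2) * exp (-d
l)` with `d = (x - m)² / 2`; after Fubini the integral over `l` is a tilted Gamma moment. -/
theorem studentT_eq_withDensity {a b : ℝ} (ha : 0 < a) (hb : 0 < b) (m : ℝ) :
    studentT m a b = volume.withDensity fun x => ENNReal.ofReal (studentPDFReal m a b x) := by
  have := isProbabilityMeasure_gammaMeasure ha hb
  have hG : 0 < Real.Gamma a := Real.Gamma_pos_of_pos ha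
  ext s hs
  have hjoint : Measurable fun z : ℝ × ℝ =>
      s.indicator (fun _ => ENNReal.ofReal (gaussianPDFReal m (Real.toNNReal z.1⁻¹) z.2)) z.2 := by
    have h1 : Measurable fun z : ℝ × ℝ =>
        ENNReal.ofReal (gaussianPDFReal m (Real.toNNReal z.1⁻¹) z.2) :=
      (measurable_uncurry_gaussianPDFReal.comp
        (measurable_const.prodMk ((measurable_fst.inv.real_toNNReal).prodMk measurable_snd))
        ).ennreal_ofReal
    exact h1.indicator (measurable_snd hs)
  rw [studentT, Measure.bind_apply hs (measurable_gaussianReal_precision m).aemeasurable,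
    withDensity_apply _ hs]
  calc ∫⁻ l, gaussianReal m (Real.toNNReal l⁻¹) s ∂(gammaMeasure a b)
      = ∫⁻ l, (∫⁻ x, s.indicator
          (fun _ => ENNReal.ofReal (gaussianPDFReal m (Real.toNNReal l⁻¹) x)) x)
          ∂(gammaMeasure a b) := by
        refine lintegral_congr_ae ?_
        filter_upwards [ae_pos_gammaMeasure a b] with l hl
        have : Real.toNNReal l⁻¹ ≠ 0 := by simpa using hl
        rw [gaussianReal_apply _ this, ← lintegral_indicator hs]
        rfl
    _ = ∫⁻ x, ∫⁻ l, s.indicator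
          (fun _ => ENNReal.ofReal (gaussianPDFReal m (Real.toNNReal l⁻¹) x)) x
          ∂(gammaMeasure a b) := lintegral_lintegral_swap hjoint.aemeasurable
    _ = ∫⁻ x, s.indicator (fun x => ENNReal.ofReal (studentPDFReal m a b x)) x := by
        refine lintegral_congr fun x => ?_
        by_cases hx : x ∈ s
        · simp only [Set.indicator_of_mem hx]
          calc ∫⁻ l, ENNReal.ofReal (gaussianPDFReal m (Real.toNNReal l⁻¹) x) ∂(gammaMeasure a b)
              = ∫⁻ l, ENNReal.ofReal (√(2 * Real.pi))⁻¹ *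
                  ENNReal.ofReal (l ^ (1 / 2 : ℝ) * Real.exp (-((x - m) ^ 2 / 2 * l)))
                  ∂(gammaMeasure a b) := by
                refine lintegral_congr_ae ?_
                filter_upwards [ae_pos_gammaMeasure a b] with l hl
                rw [← ENNReal.ofReal_mul (by positivity), gaussianPDFReal,
                  Real.coe_toNNReal _ (by positivity), ← Real.sqrt_eq_rpow, ← mul_assoc]
                congr 3
                · rw [Real.sqrt_mul (by positivity), Real.sqrt_inv, mul_inv, inv_inv]
                · field_simp
            _ = ENNReal.ofReal (studentPDFReal m a b x) := by
                rw [lintegral_const_mul _ (by fun_prop),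
                  lintegral_rpow_mul_exp_gammaMeasure ha hb (by linarith) (by positivity),
                  ← ENNReal.ofReal_mul (by positivity)]
                congr 1
                rw [studentPDFReal, studentConst]
                ring
        · simp [Set.indicator_of_notMem hx]
    _ = ∫⁻ x in s, ENNReal.ofReal (studentPDFReal m a b x) := lintegral_indicator hs _

/-- The variance of a Student law about its location. -/
theorem lintegral_sq_sub_studentT {a b : ℝ} (ha : 1 < a) (hb : 0 < b) (m : ℝ) :
    ∫⁻ x, ENNReal.ofReal ((x - m) ^ 2) ∂(studentT m a b) = ENNReal.ofReal (b / (a - 1)) := by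
  rw [lintegral_studentT m a b (by fun_prop)]
  have h1 : ∀ᵐ l ∂(gammaMeasure a b),
      ∫⁻ x, ENNReal.ofReal ((x - m) ^ 2) ∂(gaussianReal m (Real.toNNReal l⁻¹))
        = ENNReal.ofReal (l ^ (-1 : ℝ) * Real.exp (-(0 * l))) := by
    filter_upwards [ae_pos_gammaMeasure a b] with l hl
    have h := evariance_eq_lintegral_ofReal (fun x : ℝ => x)
      (gaussianReal m (Real.toNNReal l⁻¹))
    rw [integral_id_gaussianReal] at h
    rw [← h, ← ofReal_variance (X := fun x : ℝ => x) (memLp_id_gaussianReal 2), variance_fun_id_gaussianReal,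
      Real.rpow_neg_one, Real.coe_toNNReal _ (by positivity)]
    simp
  -- The mean of `l⁻¹` is the case `c = -1`, `d = 0`; its condition `0 < a + c` is where `1 < a`
  -- enters.
  rw [lintegral_congr_ae h1, lintegral_rpow_mul_exp_gammaMeasure (by linarith) hb
    (by linarith) (by linarith)]
  congr 1
  have hG : Real.Gamma a = (a - 1) * Real.Gamma (a - 1) := by
    have := Real.Gamma_add_one (s := a - 1) (by linarith)
    simpa using this
  have hG1 : 0 < Real.Gamma (a - 1) := Real.Gamma_pos_of_pos (by linarith)
  have ha1 : 0 < a - 1 := by linarith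
  have hba : b ^ a = b ^ (a - 1) * b := by
    rw [← Real.rpow_add_one hb.ne']; ring_nf
  have : 0 < b ^ (a - 1) := by positivity
  rw [hG, hba, add_zero, ← sub_eq_add_neg]
  field_simp

theorem gaussianReal_tail_le (v : ℝ≥0) (hv : v ≠ 0) {t : ℝ} (ht : 0 < t) :
    gaussianReal 0 v {x | t < |x|} ≤ ENNReal.ofReal (2 * Real.exp (-(t ^ 2 / 2 * (v : ℝ)⁻¹))) := by
  have hv0 : (0 : ℝ) < v := by positivity
  have hX : HasLaw (fun x : ℝ => x) (gaussianReal 0 v) (gaussianReal 0 v) := ⟨by fun_prop, by simp⟩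
  have upper : ∀ w : ℝ, w ^ 2 = 1 →
      (gaussianReal 0 v).real {x | t ≤ w * x} ≤ Real.exp (-(t ^ 2 / 2 * (v : ℝ)⁻¹)) := by
    intro w hw
    have h := measure_ge_le_exp_mul_mgf (μ := gaussianReal 0 v) (X := fun x => w * x) (t := t / v) t
      (by positivity) (by
        have := integrable_exp_mul_gaussianReal (μ := 0) (v := v) (t / v * w)
        simpa [mul_assoc] using this)
    refine h.trans (le_of_eq ?_)
    rw [mgf_gaussianReal (gaussianReal_const_mul hX w).map_eq, ← Real.exp_add]
    congr 1
    push_cast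
    rw [hw]
    field_simp
    ring
  have hsub : {x : ℝ | t < |x|} ⊆ {x | t ≤ 1 * x} ∪ {x | t ≤ (-1) * x} := by
    intro x hx
    rcases lt_abs.1 (show t < |x| from hx) with h | h
    · left; simpa using h.le
    · right; simpa using h.le
  calc gaussianReal 0 v {x | t < |x|}
      ≤ gaussianReal 0 v {x | t ≤ 1 * x} + gaussianReal 0 v {x | t ≤ (-1) * x} :=
        (measure_mono hsub).trans (measure_union_le _ _)
    _ ≤ ENNReal.ofReal (Real.exp (-(t ^ 2 / 2 * (v : ℝ)⁻¹)))
        + ENNReal.ofReal (Real.exp (-(t ^ 2 / 2 * (v : ℝ)⁻¹))) := by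
        rw [← ofReal_measureReal (μ := gaussianReal 0 v) (s := {x | t ≤ 1 * x}),
          ← ofReal_measureReal (μ := gaussianReal 0 v) (s := {x | t ≤ (-1) * x})]
        gcongr
        · exact upper 1 (by norm_num)
        · exact upper (-1) (by norm_num)
    _ = _ := by rw [← ENNReal.ofReal_add (by positivity) (by positivity), two_mul]

/-- Given the precision `l`, the Chernoff bound is `2 exp (-(t² / 2) l)`, so the mixture tail is at
most twice the Laplace transform of the Gamma law at `t² / 2`. -/
theorem studentT_tail_le {a b : ℝ} (ha : 0 < a) (hb : 0 < b) {t : ℝ} (ht : 0 < t) :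
    studentT 0 a b {x | t < |x|} ≤ ENNReal.ofReal (2 * (2 * b / t ^ 2) ^ a) := by
  have hs : MeasurableSet {x : ℝ | t < |x|} := measurableSet_lt measurable_const (by fun_prop)
  rw [studentT, Measure.bind_apply hs (measurable_gaussianReal_precision 0).aemeasurable]
  have hG : 0 < Real.Gamma a := Real.Gamma_pos_of_pos ha
  calc ∫⁻ l, gaussianReal 0 (Real.toNNReal l⁻¹) {x | t < |x|} ∂(gammaMeasure a b)
      ≤ ∫⁻ l, ENNReal.ofReal 2 * ENNReal.ofReal (l ^ (0 : ℝ) * Real.exp (-(t ^ 2 / 2 * l)))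
          ∂(gammaMeasure a b) := by
        refine lintegral_mono_ae ?_
        filter_upwards [ae_pos_gammaMeasure a b] with l hl
        refine (gaussianReal_tail_le _ (by simpa using hl) ht).trans (le_of_eq ?_)
        rw [← ENNReal.ofReal_mul (by positivity), Real.coe_toNNReal _ (by positivity)]
        simp
    _ = ENNReal.ofReal (2 * (b / (b + t ^ 2 / 2)) ^ a) := by
        rw [lintegral_const_mul _ (by fun_prop),
          lintegral_rpow_mul_exp_gammaMeasure ha hb (by linarith) (by positivity),
          ← ENNReal.ofReal_mul (by positivity), Real.div_rpow (by positivity) (by positivity),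
          add_zero]
        congr 1
        have : 0 < (b + t ^ 2 / 2) ^ a := by positivity
        field_simp
    _ ≤ _ := by
        have : b / (b + t ^ 2 / 2) ≤ 2 * b / t ^ 2 := by
          rw [div_le_div_iff₀ (by positivity) (by positivity)]
          nlinarith [sq_nonneg t, mul_pos hb hb]
        gcongr

/-- A shifted Student law has bounded density with respect to the centred one. -/
theorem studentPDFReal_le {a b : ℝ} (ha : 0 < a) (hb : 0 < b) (m x : ℝ) :
    studentPDFReal m a b x ≤ (2 + m ^ 2 / b) ^ (a + 1 / 2) * studentPDFReal 0 a b x := by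
  have hc := studentConst_pos ha hb
  unfold studentPDFReal
  -- This is `x² / 2 ≤ (x - m)² + m²`; the factor `m² / b` is chosen so that its product with `b`
  -- supplies the `m²`.
  have h1 : b + (x - 0) ^ 2 / 2 ≤ (2 + m ^ 2 / b) * (b + (x - m) ^ 2 / 2) := by
    have e : (2 + m ^ 2 / b) * (b + (x - m) ^ 2 / 2)
        = 2 * b + (x - m) ^ 2 + m ^ 2 + m ^ 2 / b * ((x - m) ^ 2 / 2) := by
      field_simp
      ring
    have : 0 ≤ m ^ 2 / b * ((x - m) ^ 2 / 2) := by positivity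
    nlinarith [sq_nonneg (x - m - m)]
  have h2 := Real.rpow_le_rpow (by positivity) h1 (show 0 ≤ a + 1 / 2 by linarith)
  rw [Real.mul_rpow (by positivity) (by positivity)] at h2
  rw [mul_div_assoc', div_le_div_iff₀ (by positivity) (by positivity)]
  nlinarith

theorem studentT_le_smul {a b : ℝ} (ha : 0 < a) (hb : 0 < b) (m : ℝ) :
    studentT m a b ≤ ENNReal.ofReal ((2 + m ^ 2 / b) ^ (a + 1 / 2)) • studentT 0 a b := by
  rw [studentT_eq_withDensity ha hb, studentT_eq_withDensity ha hb,
    ← withDensity_smul _ (measurable_studentPDFReal 0 a b).ennreal_ofReal]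
  refine withDensity_mono (ae_of_all _ fun x => ?_)
  simp only [Pi.smul_apply, smul_eq_mul]
  rw [← ENNReal.ofReal_mul (by positivity)]
  exact ENNReal.ofReal_le_ofReal (studentPDFReal_le ha hb m x)

/-! ### Product measures, relative entropy and extended expectations. -/

theorem lintegral_pi_prod {ι : Type*} [Fintype ι] {α : ι → Type*} [∀ i, MeasurableSpace (α i)]
    (μ : ∀ i, Measure (α i)) [∀ i, IsProbabilityMeasure (μ i)] {f : ∀ i, α i → ℝ≥0∞}
    (hf : ∀ i, Measurable (f i)) :
    ∫⁻ x, ∏ i, f i (x i) ∂(Measure.pi μ) = ∏ i, ∫⁻ t, f i t ∂(μ i) := by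
  rw [lintegral_prod_eq_prod_lintegral_of_indepFun Finset.univ (fun i (x : ∀ i, α i) => f i (x i))
    (iIndepFun_pi fun i => (hf i).aemeasurable) fun i => (hf i).comp (measurable_pi_apply i)]
  refine Finset.prod_congr rfl fun i _ => ?_
  exact (measurePreserving_eval μ i).lintegral_comp (hf i)

theorem rnDeriv_le_of_le_smul {α : Type*} [MeasurableSpace α] {μ ν : Measure α}
    [IsFiniteMeasure μ] [IsFiniteMeasure ν] {c : ℝ≥0∞} (h : μ ≤ c • ν) :
    ∀ᵐ x ∂ν, μ.rnDeriv ν x ≤ c := by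
  refine ae_le_of_forall_setLIntegral_le_of_sigmaFinite (μ := ν) (g := fun _ => c)
    (Measure.measurable_rnDeriv μ ν) fun s _ _ => ?_
  calc ∫⁻ x in s, μ.rnDeriv ν x ∂ν ≤ μ s := Measure.setLIntegral_rnDeriv_le s
    _ ≤ (c • ν) s := h s
    _ = ∫⁻ _ in s, c ∂ν := by simp

theorem absolutelyContinuous_of_le_smul_measure {α : Type*} [MeasurableSpace α] {μ ν : Measure α}
    {c : ℝ≥0∞} (h : μ ≤ c • ν) : μ ≪ ν :=
  fun s hs => le_antisymm ((h s).trans (by simp [hs])) zero_le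

/-- Domination of the factors by multiples implies domination of the product measures. -/
theorem pi_le_smul_pi {ι : Type*} [Fintype ι] {α : ι → Type*} [∀ i, MeasurableSpace (α i)]
    {μ ν : ∀ i, Measure (α i)} [∀ i, IsProbabilityMeasure (μ i)] [∀ i, IsProbabilityMeasure (ν i)]
    {c : ι → ℝ≥0∞} (h : ∀ i, μ i ≤ c i • ν i) :
    Measure.pi μ ≤ (∏ i, c i) • Measure.pi ν := by
  classical
  set f : ∀ i, α i → ℝ≥0∞ := fun i => (μ i).rnDeriv (ν i) with hf
  have hfm : ∀ i, Measurable (f i) := fun i => Measure.measurable_rnDeriv _ _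
  have e : Measure.pi μ = (Measure.pi ν).withDensity fun x => ∏ i, f i (x i) := by
    refine Measure.pi_eq fun s hs => ?_
    rw [withDensity_apply _ (MeasurableSet.univ_pi hs),
      ← lintegral_indicator (MeasurableSet.univ_pi hs)]
    have : ∀ x : ∀ i, α i, (Set.univ.pi s).indicator (fun x => ∏ i, f i (x i)) x
        = ∏ i, (s i).indicator (f i) (x i) := by
      intro x
      by_cases hx : x ∈ Set.univ.pi s
      · rw [Set.indicator_of_mem hx]
        exact Finset.prod_congr rfl fun i _ => (Set.indicator_of_mem (hx i trivial) _).symm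
      · rw [Set.indicator_of_notMem hx]
        obtain ⟨i, hi⟩ : ∃ i, x i ∉ s i := by simpa [Set.mem_pi] using hx
        exact (Finset.prod_eq_zero (Finset.mem_univ i) (Set.indicator_of_notMem hi _)).symm
    simp_rw [this]
    rw [lintegral_pi_prod ν fun i => (hfm i).indicator (hs i)]
    refine Finset.prod_congr rfl fun i _ => ?_
    rw [lintegral_indicator (hs i),
      Measure.setLIntegral_rnDeriv (absolutelyContinuous_of_le_smul_measure (h i))]
  have hle : ∀ᵐ x ∂(Measure.pi ν), ∏ i, f i (x i) ≤ ∏ i, c i := by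
    have : ∀ᵐ x ∂(Measure.pi ν), ∀ i, f i (x i) ≤ c i := by
      rw [ae_all_iff]
      exact fun i => (Measure.quasiMeasurePreserving_eval ν i).ae (rnDeriv_le_of_le_smul (h i))
    filter_upwards [this] with x hx
    exact Finset.prod_le_prod' fun i _ => hx i
  calc Measure.pi μ = (Measure.pi ν).withDensity fun x => ∏ i, f i (x i) := e
    _ ≤ (Measure.pi ν).withDensity fun _ => ∏ i, c i := withDensity_mono hle
    _ = _ := withDensity_const _

/-- A density bounded by `C` gives a relative entropy of at most `log C`. -/
theorem klDiv_le_log_of_le_smul {α : Type*} [MeasurableSpace α] {μ ν : Measure α}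
    [IsProbabilityMeasure μ] [IsProbabilityMeasure ν] {C : ℝ} (hC : 0 < C)
    (h : μ ≤ ENNReal.ofReal C • ν) :
    InformationTheory.klDiv μ ν ≤ ENNReal.ofReal (Real.log C) := by
  have hac := absolutelyContinuous_of_le_smul_measure h
  rw [InformationTheory.klDiv_eq_lintegral_klFun_of_ac hac]
  -- Bounding `log` by `log C` in `klFun t = t log t + 1 - t` leaves a majorant affine in the
  -- density, which integrates to `log C` since the density has integral one.
  have hbd : ∀ᵐ x ∂ν, InformationTheory.klFun (μ.rnDeriv ν x).toReal
      ≤ (μ.rnDeriv ν x).toReal * Real.log C + 1 - (μ.rnDeriv ν x).toReal := by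
    filter_upwards [rnDeriv_le_of_le_smul h] with x hx
    have hx' : (μ.rnDeriv ν x).toReal ≤ C := ENNReal.toReal_le_of_le_ofReal hC.le hx
    rw [InformationTheory.klFun_apply]
    rcases (ENNReal.toReal_nonneg (a := μ.rnDeriv ν x)).eq_or_lt with h0 | h0
    · simp [← h0]
    · have := Real.log_le_log h0 hx'
      nlinarith
  have hint : Integrable (fun x => (μ.rnDeriv ν x).toReal) ν := Measure.integrable_toReal_rnDeriv
  have hint' : Integrable (fun x => (μ.rnDeriv ν x).toReal * Real.log C + 1
      - (μ.rnDeriv ν x).toReal) ν := ((hint.mul_const _).add (integrable_const _)).sub hint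
  calc ∫⁻ x, ENNReal.ofReal (InformationTheory.klFun (μ.rnDeriv ν x).toReal) ∂ν
      ≤ ∫⁻ x, ENNReal.ofReal ((μ.rnDeriv ν x).toReal * Real.log C + 1
          - (μ.rnDeriv ν x).toReal) ∂ν := by
        refine lintegral_mono_ae ?_
        filter_upwards [hbd] with x hx
        exact ENNReal.ofReal_le_ofReal hx
    _ = ENNReal.ofReal (∫ x, ((μ.rnDeriv ν x).toReal * Real.log C + 1
          - (μ.rnDeriv ν x).toReal) ∂ν) := by
        rw [ofReal_integral_eq_lintegral_ofReal hint']
        filter_upwards [hbd] with x hx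
        exact (InformationTheory.klFun_nonneg ENNReal.toReal_nonneg).trans hx
    _ = ENNReal.ofReal (Real.log C) := by
        have hint1 : Integrable (fun x => (μ.rnDeriv ν x).toReal * Real.log C + 1) ν :=
          (hint.mul_const _).add (integrable_const _)
        rw [integral_sub hint1 hint, integral_add (hint.mul_const _) (integrable_const _), integral_mul_const,
          Measure.integral_toReal_rnDeriv hac]
        simp

/-- The Donsker--Varadhan inequality. -/
theorem integral_le_klDiv_add_log_integral_exp {α : Type*} [MeasurableSpace α] {μ ν : Measure α}
    [IsProbabilityMeasure μ] [IsProbabilityMeasure ν] {g : α → ℝ}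
    (hkl : InformationTheory.klDiv μ ν ≠ ∞) (hg : Integrable g μ)
    (hexp : Integrable (fun x => Real.exp (g x)) ν) :
    ∫ x, g x ∂μ ≤ (InformationTheory.klDiv μ ν).toReal + Real.log (∫ x, Real.exp (g x) ∂ν) := by
  obtain ⟨hac, hllr⟩ := InformationTheory.klDiv_ne_top_iff.1 hkl
  have := isProbabilityMeasure_tilted hexp
  -- Relative to the tilted law the entropy of `μ` is `KL(μ ‖ ν) - ∫ g dμ + log ∫ exp g dν`; its
  -- nonnegativity is the claim.
  have h1 := integral_llr_tilted_right hac hg hexp hllr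
  have h2 := InformationTheory.integral_llr_add_sub_measure_univ_nonneg
    (hac.trans (absolutelyContinuous_tilted hexp))
    (integrable_llr_tilted_right hac hg hllr hexp)
  rw [InformationTheory.toReal_klDiv_of_measure_eq hac (by simp)]
  simp only [probReal_univ] at h2
  linarith

theorem extExpectation_of_integrable {α : Type*} [MeasurableSpace α] {q : Measure α} {f : α → ℝ}
    (hf : Integrable f q) : extExpectation q f = ((∫ x, f x ∂q : ℝ) : EReal) := by
  have h1 : ∫⁻ x, ENNReal.ofReal (f x) ∂q ≠ ∞ := hf.lintegral_lt_top.ne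
  have h2 : ∫⁻ x, ENNReal.ofReal (-f x) ∂q ≠ ∞ := hf.neg.lintegral_lt_top.ne
  rw [extExpectation, integral_eq_lintegral_pos_part_sub_lintegral_neg_part hf, EReal.coe_sub,
    EReal.coe_ennreal_toReal h1, EReal.coe_ennreal_toReal h2]

theorem integrable_of_extExpectation_ne_top {α : Type*} [MeasurableSpace α] {q : Measure α}
    [IsFiniteMeasure q] {f : α → ℝ} (hfm : Measurable f) {c : ℝ} (hc : ∀ x, c ≤ f x)
    (hf : extExpectation q f ≠ ⊤) : Integrable f q := by
  have hneg : ∫⁻ x, ENNReal.ofReal (-f x) ∂q ≠ ∞ := by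
    refine ((lintegral_mono (g := fun _ => ENNReal.ofReal (-c)) fun x =>
      ENNReal.ofReal_le_ofReal (neg_le_neg (hc x))).trans_lt ?_).ne
    rw [lintegral_const]
    exact ENNReal.mul_lt_top ENNReal.ofReal_lt_top (measure_lt_top _ _)
  have hpos : ∫⁻ x, ENNReal.ofReal (f x) ∂q ≠ ∞ := by
    intro h
    apply hf
    rw [extExpectation, h, ← EReal.coe_ennreal_toReal hneg]
    simp
  refine ⟨hfm.aestronglyMeasurable, ?_⟩
  rw [hasFiniteIntegral_iff_norm]
  calc ∫⁻ x, ENNReal.ofReal ‖f x‖ ∂q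
      ≤ ∫⁻ x, (ENNReal.ofReal (f x) + ENNReal.ofReal (-f x)) ∂q := by
        refine lintegral_mono fun x => ?_
        rcases le_total 0 (f x) with h | h
        · rw [Real.norm_of_nonneg h]; exact le_self_add
        · rw [Real.norm_of_nonpos h]; exact le_add_self
    _ < ∞ := by
        rw [lintegral_add_left hfm.ennreal_ofReal]
        exact ENNReal.add_lt_top.2 ⟨hpos.lt_top, hneg.lt_top⟩

/-! ### Gaussian noise and the standardised likelihood. -/

/-- The exponential martingale identity for a standard Gaussian vector. -/
theorem lintegral_exp_dotProduct_gaussian {n : ℕ} (w : Fin n → ℝ) :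
    ∫⁻ ε, ENNReal.ofReal (Real.exp (w ⬝ᵥ ε - w ⬝ᵥ w / 2))
      ∂(Measure.pi fun _ : Fin n => gaussianReal 0 1) = 1 := by
  have h1 : ∀ ε : Fin n → ℝ, ENNReal.ofReal (Real.exp (w ⬝ᵥ ε - w ⬝ᵥ w / 2))
      = ∏ i, ENNReal.ofReal (Real.exp (w i * ε i - w i * w i / 2)) := by
    intro ε
    rw [← ENNReal.ofReal_prod_of_nonneg fun i _ => (Real.exp_pos _).le, ← Real.exp_sum,
      Finset.sum_sub_distrib, ← Finset.sum_div]
    rfl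
  simp_rw [h1]
  rw [lintegral_pi_prod (fun _ : Fin n => gaussianReal 0 1)
    (f := fun i t => ENNReal.ofReal (Real.exp (w i * t - w i * w i / 2))) fun i => by fun_prop]
  refine Finset.prod_eq_one fun i _ => ?_
  have hint : Integrable (fun t => Real.exp (w i * t - w i * w i / 2)) (gaussianReal 0 1) := by
    simp_rw [Real.exp_sub]
    exact (integrable_exp_mul_gaussianReal (w i)).div_const _
  rw [← ofReal_integral_eq_lintegral_ofReal hint (ae_of_all _ fun _ => (Real.exp_pos _).le)]
  have hm := congrFun (mgf_fun_id_gaussianReal (μ := 0) (v := 1)) (w i)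
  simp_rw [Real.exp_sub]
  rw [integral_div]
  simp only [mgf] at hm
  rw [hm]
  simp [sq]

/-- The standardised signal `σ⁻¹ X (β - β₀)`. -/
noncomputable def signal {n p : ℕ} (X : Matrix (Fin n) (Fin p) ℝ) (σ : ℝ) (β₀ β : Fin p → ℝ) :
    Fin n → ℝ :=
  σ⁻¹ • (X *ᵥ (β - β₀))

/-- The standardised residual `σ⁻¹ (y - X β₀)`. -/
noncomputable def stdResidual {n p : ℕ} (X : Matrix (Fin n) (Fin p) ℝ) (σ : ℝ) (β₀ : Fin p → ℝ)
    (y : Fin n → ℝ) : Fin n → ℝ :=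
  σ⁻¹ • (y - X *ᵥ β₀)

/-- The negative log-likelihood at the true coefficient vector. -/
noncomputable def baseline {n p : ℕ} (X : Matrix (Fin n) (Fin p) ℝ) (σ : ℝ) (β₀ : Fin p → ℝ)
    (y : Fin n → ℝ) : ℝ :=
  n * Real.log (√(2 * Real.pi * σ ^ 2)) + stdResidual X σ β₀ y ⬝ᵥ stdResidual X σ β₀ y / 2

theorem neg_log_likelihood {n p : ℕ} (X : Matrix (Fin n) (Fin p) ℝ) {σ : ℝ} (hσ : 0 < σ)
    (β₀ β : Fin p → ℝ) (y : Fin n → ℝ) :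
    -Real.log (likelihood X σ y β) = baseline X σ β₀ y
      + (signal X σ β₀ β ⬝ᵥ signal X σ β₀ β / 2 - signal X σ β₀ β ⬝ᵥ stdResidual X σ β₀ y) := by
  have hv : Real.toNNReal (σ ^ 2) ≠ 0 := by simpa using hσ.ne'
  have hs : 0 < √(2 * Real.pi * σ ^ 2) := by positivity
  have h1 : ∀ i, -Real.log (gaussianPDFReal ((X *ᵥ β) i) (Real.toNNReal (σ ^ 2)) (y i))
      = Real.log (√(2 * Real.pi * σ ^ 2))
        + (stdResidual X σ β₀ y i * stdResidual X σ β₀ y i / 2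
        + (signal X σ β₀ β i * signal X σ β₀ β i / 2
          - signal X σ β₀ β i * stdResidual X σ β₀ y i)) := by
    intro i
    rw [gaussianPDFReal, Real.coe_toNNReal _ (by positivity),
      Real.log_mul (by positivity) (Real.exp_pos _).ne', Real.log_exp, Real.log_inv]
    simp only [stdResidual, signal, Matrix.mulVec_sub, Pi.smul_apply, Pi.sub_apply, smul_eq_mul]
    field_simp
    ring
  rw [likelihood, Real.log_prod fun i _ => (gaussianPDFReal_pos _ _ _ hv).ne',
    ← Finset.sum_neg_distrib]
  simp_rw [h1]
  simp only [baseline, dotProduct, Finset.sum_add_distrib, Finset.sum_sub_distrib, Finset.sum_div]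
  simp
  ring

theorem measurable_signal {n p : ℕ} (X : Matrix (Fin n) (Fin p) ℝ) (σ : ℝ) (β₀ : Fin p → ℝ) :
    Measurable (signal X σ β₀) := by
  unfold signal Matrix.mulVec dotProduct
  fun_prop

theorem measurable_stdResidual {n p : ℕ} (X : Matrix (Fin n) (Fin p) ℝ) (σ : ℝ) (β₀ : Fin p → ℝ) :
    Measurable (stdResidual X σ β₀) := by
  unfold stdResidual
  fun_prop

theorem measurable_dotProduct {α : Type*} [MeasurableSpace α] {n : ℕ} {f g : α → Fin n → ℝ}
    (hf : Measurable f) (hg : Measurable g) : Measurable fun x => f x ⬝ᵥ g x := by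
  unfold dotProduct
  fun_prop

/-! ### Deterministic inequalities for the design. -/

theorem mulVec_dotProduct_eq_sum {n p : ℕ} (X : Matrix (Fin n) (Fin p) ℝ) (Δ : Fin p → ℝ)
    (e : Fin n → ℝ) : (X *ᵥ Δ) ⬝ᵥ e = ∑ j, Δ j * (Xᵀ *ᵥ e) j := by
  rw [dotProduct_comm, Matrix.dotProduct_mulVec, ← Matrix.mulVec_transpose, dotProduct_comm]
  rfl

theorem mulVec_dotProduct_self_le {n p : ℕ} {X : Matrix (Fin n) (Fin p) ℝ}
    (hcol : ∀ j, ∑ i, X i j ^ 2 ≤ (n : ℝ)) (Δ : Fin p → ℝ) :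
    (X *ᵥ Δ) ⬝ᵥ (X *ᵥ Δ) ≤ n * p * ∑ j, Δ j ^ 2 := by
  calc (X *ᵥ Δ) ⬝ᵥ (X *ᵥ Δ) = ∑ i, (∑ j, X i j * Δ j) ^ 2 := by
        simp only [dotProduct, Matrix.mulVec, sq]
    _ ≤ ∑ i, (∑ j, X i j ^ 2) * ∑ j, Δ j ^ 2 :=
        Finset.sum_le_sum fun i _ => Finset.sum_mul_sq_le_sq_mul_sq _ _ _
    _ = (∑ j, ∑ i, X i j ^ 2) * ∑ j, Δ j ^ 2 := by rw [← Finset.sum_mul, Finset.sum_comm]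
    _ ≤ (∑ _j : Fin p, (n : ℝ)) * ∑ j, Δ j ^ 2 := by
        gcongr with j
        exact hcol j
    _ = n * p * ∑ j, Δ j ^ 2 := by
        rw [Finset.sum_const, Finset.card_univ, Fintype.card_fin, nsmul_eq_mul]; ring

/-- The `ℓ₂` norm of `X Δ` is at most `√n` times the `ℓ₁` norm of `Δ`. -/
theorem mulVec_dotProduct_self_le_sq_sum_abs {n p : ℕ} {X : Matrix (Fin n) (Fin p) ℝ}
    (hcol : ∀ j, ∑ i, X i j ^ 2 ≤ (n : ℝ)) (Δ : Fin p → ℝ) :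
    (X *ᵥ Δ) ⬝ᵥ (X *ᵥ Δ) ≤ n * (∑ j, |Δ j|) ^ 2 := by
  calc (X *ᵥ Δ) ⬝ᵥ (X *ᵥ Δ) = ∑ i, (∑ j, X i j * Δ j) ^ 2 := by
        simp only [dotProduct, Matrix.mulVec, sq]
    _ ≤ ∑ i, (∑ j, |Δ j|) * ∑ j, |Δ j| * X i j ^ 2 := by
        refine Finset.sum_le_sum fun i _ => ?_
        refine Finset.sum_sq_le_sum_mul_sum_of_sq_le_mul _ (fun j _ => abs_nonneg _)
          (fun j _ => by positivity) fun j _ => le_of_eq ?_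
        rw [mul_pow, ← sq_abs (Δ j)]
        ring
    _ = (∑ j, |Δ j|) * ∑ j, |Δ j| * ∑ i, X i j ^ 2 := by
        rw [← Finset.mul_sum, Finset.sum_comm]
        simp_rw [Finset.mul_sum]
    _ ≤ (∑ j, |Δ j|) * ∑ j, |Δ j| * n := by
        gcongr with j
        exact hcol j
    _ = n * (∑ j, |Δ j|) ^ 2 := by rw [← Finset.sum_mul]; ring

/-- A lower bound on the eigenvalues of the Gram matrix is a lower bound on its quadratic form. -/
theorem sum_sq_le_of_eigenvalue_bound {n p : ℕ} (X : Matrix (Fin n) (Fin p) ℝ)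
    (ξ : Finset (Fin p)) {c : ℝ}
    (h : ∀ t : ℝ, Module.End.HasEigenvalue
        (Matrix.toLin' ((columnSubmatrix X ξ)ᵀ * columnSubmatrix X ξ)) t → c < t)
    (u : Fin p → ℝ) :
    c * ∑ j ∈ ξ, u j ^ 2
      ≤ (X *ᵥ fun j => if j ∈ ξ then u j else 0) ⬝ᵥ (X *ᵥ fun j => if j ∈ ξ then u j else 0) := by
  set Y := columnSubmatrix X ξ with hY
  -- An eigenvalue `μ` of the shifted Gram matrix makes `μ + c` an eigenvalue of the Gram matrix, so
  -- `μ > 0`; the shifted matrix is therefore positive semidefinite.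
  set A : Matrix ξ ξ ℝ := Yᵀ * Y - c • 1 with hA
  have hherm : A.IsHermitian := by
    rw [Matrix.IsHermitian, hA, Matrix.conjTranspose_sub]
    congr 1
    · rw [Matrix.conjTranspose_mul]; rfl
    · simp
  have hpsd : A.PosSemidef := by
    rw [hherm.posSemidef_iff_eigenvalues_nonneg]
    intro i
    have hev := hherm.mulVec_eigenvectorBasis i
    set w : ξ → ℝ := ⇑(hherm.eigenvectorBasis i) with hw
    have hw0 : w ≠ 0 := by
      intro h0
      apply (hherm.eigenvectorBasis.orthonormal.ne_zero i)
      ext j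
      exact congrFun h0 j
    have : Module.End.HasEigenvalue (Matrix.toLin' (Yᵀ * Y)) (hherm.eigenvalues i + c) := by
      refine Module.End.hasEigenvalue_of_hasEigenvector (x := w) ⟨?_, hw0⟩
      rw [Module.End.mem_eigenspace_iff, Matrix.toLin'_apply]
      have h2 : (Yᵀ * Y) *ᵥ w = A *ᵥ w + c • w := by
        rw [hA, Matrix.sub_mulVec, Matrix.smul_mulVec, Matrix.one_mulVec]
        abel
      rw [h2, hev, add_smul]
    have := h _ this
    simp only [Pi.zero_apply]
    linarith
  have hq := hpsd.dotProduct_mulVec_nonneg (fun j : ξ => u j)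
  have hYu : Y *ᵥ (fun j : ξ => u j) = X *ᵥ fun j => if j ∈ ξ then u j else 0 := by
    ext i
    simp only [Matrix.mulVec, dotProduct, hY, columnSubmatrix, Matrix.submatrix_apply, id,
      mul_ite, mul_zero, Finset.sum_ite_mem, Finset.univ_inter]
    exact Finset.sum_coe_sort ξ fun j => X i j * u j
  have hsum : (fun j : ξ => u j) ⬝ᵥ (fun j : ξ => u j) = ∑ j ∈ ξ, u j ^ 2 := by
    simp only [dotProduct, ← sq]
    exact Finset.sum_coe_sort ξ fun j => u j ^ 2
  rw [star_trivial, hA, Matrix.sub_mulVec, Matrix.smul_mulVec, Matrix.one_mulVec, dotProduct_sub,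
    dotProduct_smul, hsum, ← Matrix.mulVec_mulVec, Matrix.dotProduct_mulVec,
    Matrix.vecMul_transpose, hYu, smul_eq_mul] at hq
  linarith

/-- If `Δ` is small off `S`, the restricted eigenvalue condition on `S` controls `Δ` on `S`. -/
theorem restricted_sum_sq_le {n p : ℕ} {X : Matrix (Fin n) (Fin p) ℝ}
    (hcol : ∀ j, ∑ i, X i j ^ 2 ≤ (n : ℝ)) {lam R : ℝ} (S : Finset (Fin p)) (Δ : Fin p → ℝ)
    (hRE : n * lam * ∑ j ∈ S, Δ j ^ 2
      ≤ (X *ᵥ fun j => if j ∈ S then Δ j else 0) ⬝ᵥ (X *ᵥ fun j => if j ∈ S then Δ j else 0))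
    (hR : ∑ j ∈ Sᶜ, |Δ j| ≤ R) :
    n * lam * ∑ j ∈ S, Δ j ^ 2 ≤ 2 * ((X *ᵥ Δ) ⬝ᵥ (X *ᵥ Δ) + n * R ^ 2) := by
  set Δ₁ : Fin p → ℝ := fun j => if j ∈ S then Δ j else 0 with h1
  set Δ₂ : Fin p → ℝ := fun j => if j ∈ Sᶜ then Δ j else 0 with h2
  have hdec : X *ᵥ Δ₁ = X *ᵥ Δ - X *ᵥ Δ₂ := by
    rw [← Matrix.mulVec_sub]
    congr 1
    ext j
    by_cases hj : j ∈ S <;> simp [h1, h2, hj]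
  have hsum : ∑ j, |Δ₂ j| = ∑ j ∈ Sᶜ, |Δ j| := by
    rw [← Finset.sum_subset (Finset.subset_univ Sᶜ)]
    · exact Finset.sum_congr rfl fun j hj => by simp only [h2, if_pos hj]
    · intro j _ hj
      simp only [h2, if_neg hj, abs_zero]
  have hb : (X *ᵥ Δ₂) ⬝ᵥ (X *ᵥ Δ₂) ≤ n * R ^ 2 := by
    refine (mulVec_dotProduct_self_le_sq_sum_abs hcol Δ₂).trans ?_
    rw [hsum]
    have : 0 ≤ ∑ j ∈ Sᶜ, |Δ j| := Finset.sum_nonneg fun _ _ => abs_nonneg _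
    gcongr
  have htri : (X *ᵥ Δ - X *ᵥ Δ₂) ⬝ᵥ (X *ᵥ Δ - X *ᵥ Δ₂)
      ≤ 2 * ((X *ᵥ Δ) ⬝ᵥ (X *ᵥ Δ) + (X *ᵥ Δ₂) ⬝ᵥ (X *ᵥ Δ₂)) := by
    simp only [dotProduct, ← Finset.sum_add_distrib, Finset.mul_sum, Pi.sub_apply]
    refine Finset.sum_le_sum fun i _ => ?_
    nlinarith [sq_nonneg ((X *ᵥ Δ) i + (X *ᵥ Δ₂) i)]
  rw [hdec] at hRE
  linarith

/-- The cross term between signal and noise is absorbed by the signal, up to `|S| L`. -/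
theorem cross_term_le {n p : ℕ} {X : Matrix (Fin n) (Fin p) ℝ}
    {σ lam R L τ s : ℝ} (hn : 0 < n) (hσ : 0 < σ) (hlam : 0 < lam)
    (hL : 0 ≤ L) (hτ0 : 0 ≤ τ)
    (S : Finset (Fin p)) (Δ : Fin p → ℝ) (e : Fin n → ℝ)
    (hS : n * lam * ∑ j ∈ S, Δ j ^ 2 ≤ 2 * ((X *ᵥ Δ) ⬝ᵥ (X *ᵥ Δ) + n * R ^ 2))
    (hR : ∑ j ∈ Sᶜ, |Δ j| ≤ R) (he : ∀ j, |(Xᵀ *ᵥ e) j| ≤ τ)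
    (hnR : n * R ^ 2 ≤ s * L) (hτ : τ ^ 2 ≤ 25 / 4 * (n * L)) (hτR : τ * R ≤ 5 / 2 * (s * L))
    (hs : s ≤ S.card) (hSpos : 0 < S.card) :
    (σ⁻¹ • (X *ᵥ Δ)) ⬝ᵥ e ≤ (σ⁻¹ • (X *ᵥ Δ)) ⬝ᵥ (σ⁻¹ • (X *ᵥ Δ)) / 4
      + (25 / 2 / lam + σ⁻¹ ^ 2 / 4 + 5 / 2 * σ⁻¹) * (S.card * L) := by
  set A := ∑ j ∈ S, |Δ j| with hA
  set G := (X *ᵥ Δ) ⬝ᵥ (X *ᵥ Δ) with hG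
  have hn' : (0 : ℝ) < n := by exact_mod_cast hn
  have hSp : (0 : ℝ) < S.card := by exact_mod_cast hSpos
  have hcross : (X *ᵥ Δ) ⬝ᵥ e ≤ τ * A + τ * R := by
    rw [mulVec_dotProduct_eq_sum, ← Finset.sum_add_sum_compl S]
    have hterm : ∀ j, Δ j * (Xᵀ *ᵥ e) j ≤ τ * |Δ j| := fun j => by
      calc Δ j * (Xᵀ *ᵥ e) j ≤ |Δ j| * |(Xᵀ *ᵥ e) j| := by
            rw [← abs_mul]; exact le_abs_self _
        _ ≤ |Δ j| * τ := by gcongr; exact he j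
        _ = _ := mul_comm _ _
    refine add_le_add ?_ ?_
    · rw [hA, Finset.mul_sum]; exact Finset.sum_le_sum fun j _ => hterm j
    · calc ∑ j ∈ Sᶜ, Δ j * (Xᵀ *ᵥ e) j ≤ τ * ∑ j ∈ Sᶜ, |Δ j| := by
            rw [Finset.mul_sum]; exact Finset.sum_le_sum fun j _ => hterm j
        _ ≤ τ * R := by gcongr
  have hA2 : A ^ 2 ≤ S.card * ∑ j ∈ S, Δ j ^ 2 := by
    have := sq_sum_le_card_mul_sum_sq (s := S) (f := fun j => |Δ j|)
    simpa [sq_abs] using this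
  -- The weight for Young's inequality: with it `κ A²` is at most a quarter of `G + n R²`, while `τ²
  -- / (4 κ)` is of order `|S| L`.
  set κ := n * lam / (8 * S.card) with hκ
  have hκ0 : 0 < κ := by positivity
  have hκA : κ * A ^ 2 ≤ (G + n * R ^ 2) / 4 := by
    calc κ * A ^ 2 ≤ κ * (S.card * ∑ j ∈ S, Δ j ^ 2) := by gcongr
      _ = (n * lam * ∑ j ∈ S, Δ j ^ 2) / 8 := by rw [hκ]; field_simp
      _ ≤ _ := by linarith
  have hamgm : σ⁻¹ * (τ * A) ≤ σ⁻¹ ^ 2 * (κ * A ^ 2) + τ ^ 2 / (4 * κ) := by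
    have h1 : τ ^ 2 / (4 * κ) * (4 * κ) = τ ^ 2 := div_mul_cancel₀ _ (by positivity)
    have h2 := sq_nonneg (2 * κ * (σ⁻¹ * A) - τ)
    have h3 : 4 * κ * (σ⁻¹ * (τ * A)) ≤ 4 * κ * (σ⁻¹ ^ 2 * (κ * A ^ 2) + τ ^ 2 / (4 * κ)) := by
      nlinarith
    exact le_of_mul_le_mul_left h3 (by positivity)
  have hτκ : τ ^ 2 / (4 * κ) ≤ 25 / 2 / lam * (S.card * L) := by
    rw [div_le_iff₀ (by positivity)]
    refine hτ.trans (le_of_eq ?_)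
    rw [hκ]
    field_simp
    ring
  have hsL : s * L ≤ S.card * L := by gcongr
  have hσ' : 0 < σ⁻¹ := inv_pos.2 hσ
  rw [smul_dotProduct, smul_dotProduct, dotProduct_smul, smul_eq_mul, smul_eq_mul, smul_eq_mul,
    ← hG]
  have h1 : σ⁻¹ * ((X *ᵥ Δ) ⬝ᵥ e) ≤ σ⁻¹ * (τ * A + τ * R) := by gcongr
  have h2 : σ⁻¹ * (τ * R) ≤ σ⁻¹ * (5 / 2 * (S.card * L)) :=
    mul_le_mul_of_nonneg_left (by linarith) hσ'.le
  have h3 : σ⁻¹ ^ 2 * (κ * A ^ 2) ≤ σ⁻¹ ^ 2 * ((G + S.card * L) / 4) := by gcongr; linarith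
  nlinarith

/-- The signal stays below a multiple of the squared distance plus the noise level. -/
theorem signal_sub_cross_le {n p : ℕ} {X : Matrix (Fin n) (Fin p) ℝ}
    (hcol : ∀ j, ∑ i, X i j ^ 2 ≤ (n : ℝ)) {σ L τ : ℝ} (hn : 0 < n) (hσ : 0 < σ)
    (β₀ β : Fin p → ℝ) (e : Fin n → ℝ)
    (he : ∀ j, |(Xᵀ *ᵥ e) j| ≤ τ) (hτ : τ ^ 2 ≤ 25 / 4 * (n * L)) :
    signal X σ β₀ β ⬝ᵥ signal X σ β₀ β / 2 - signal X σ β₀ β ⬝ᵥ e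
      ≤ (σ⁻¹ ^ 2 / 2 + σ⁻¹ / 2) * (n * p) * ∑ j, (β j - β₀ j) ^ 2 + 25 / 8 * σ⁻¹ * L := by
  have hn' : (0 : ℝ) < n := by exact_mod_cast hn
  have hσ' : 0 < σ⁻¹ := inv_pos.2 hσ
  have h1 := mulVec_dotProduct_self_le hcol (β - β₀)
  have h2 : -((X *ᵥ (β - β₀)) ⬝ᵥ e) ≤ n * p * (∑ j, (β j - β₀ j) ^ 2) / 2 + 25 / 8 * L := by
    rw [mulVec_dotProduct_eq_sum, ← Finset.sum_neg_distrib]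
    have hA : (∑ j, |β j - β₀ j|) ^ 2 ≤ p * ∑ j, (β j - β₀ j) ^ 2 := by
      have := sq_sum_le_card_mul_sum_sq (s := Finset.univ) (f := fun j => |β j - β₀ j|)
      simpa [sq_abs] using this
    have h3 : ∑ j, -((β - β₀) j * (Xᵀ *ᵥ e) j) ≤ τ * ∑ j, |β j - β₀ j| := by
      rw [Finset.mul_sum]
      refine Finset.sum_le_sum fun j _ => ?_
      calc -((β - β₀) j * (Xᵀ *ᵥ e) j) ≤ |β j - β₀ j| * |(Xᵀ *ᵥ e) j| := by
            rw [← abs_mul]; exact neg_le_abs _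
        _ ≤ |β j - β₀ j| * τ := by gcongr; exact he j
        _ = _ := mul_comm _ _
    set A := ∑ j, |β j - β₀ j|
    -- Young's inequality `τ A ≤ n A² / 2 + τ² / (2 n)`, multiplied by `n`.
    have h4 : n * (τ * A) ≤ n * (n * A ^ 2 / 2 + 25 / 8 * L) := by
      nlinarith [sq_nonneg (τ - n * A)]
    have h5 := le_of_mul_le_mul_left h4 hn'
    have h6 : n * A ^ 2 ≤ n * (p * ∑ j, (β j - β₀ j) ^ 2) := by gcongr
    linarith
  rw [signal, smul_dotProduct, smul_dotProduct, dotProduct_smul, smul_eq_mul, smul_eq_mul,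
    smul_eq_mul]
  simp only [Pi.sub_apply] at h1
  have h3 : σ⁻¹ * -((X *ᵥ (β - β₀)) ⬝ᵥ e)
      ≤ σ⁻¹ * (n * p * (∑ j, (β j - β₀ j) ^ 2) / 2 + 25 / 8 * L) := by gcongr
  have h4 : σ⁻¹ ^ 2 * ((X *ᵥ (β - β₀)) ⬝ᵥ (X *ᵥ (β - β₀)))
      ≤ σ⁻¹ ^ 2 * (n * p * ∑ j, (β j - β₀ j) ^ 2) := by gcongr
  nlinarith

/-! ### Large coordinates and their exponential moment under the prior. -/

/-- The number of coordinates exceeding `r` in absolute value. -/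
noncomputable def largeCount {p : ℕ} (r : ℝ) (β : Fin p → ℝ) : ℕ :=
  (Finset.univ.filter fun j => r < |β j|).card

theorem largeCount_eq_sum {p : ℕ} (r : ℝ) (β : Fin p → ℝ) :
    (largeCount r β : ℝ) = ∑ j, {x : ℝ | r < |x|}.indicator (fun _ => (1 : ℝ)) (β j) := by
  classical
  rw [largeCount, Finset.card_filter]
  push_cast
  refine Finset.sum_congr rfl fun j _ => ?_
  by_cases h : r < |β j| <;> simp [h]

theorem measurableSet_lt_abs (r : ℝ) : MeasurableSet {x : ℝ | r < |x|} :=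
  measurableSet_lt measurable_const (by fun_prop)

theorem measurable_largeCount_real {p : ℕ} (r : ℝ) :
    Measurable fun β : Fin p → ℝ => (largeCount r β : ℝ) := by
  simp_rw [largeCount_eq_sum]
  exact Finset.measurable_sum _ fun j _ =>
    (measurable_const.indicator (measurableSet_lt_abs r)).comp (measurable_pi_apply j)

theorem measurableSet_largeCount_add_le {p : ℕ} (r : ℝ) (s m : ℕ) :
    MeasurableSet {β : Fin p → ℝ | largeCount r β + s ≤ m} := by
  have : {β : Fin p → ℝ | largeCount r β + s ≤ m}
      = {β : Fin p → ℝ | (largeCount r β : ℝ) + s ≤ m} := by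
    ext β
    simp only [Set.mem_ofPred_eq]
    exact_mod_cast Iff.rfl
  rw [this]
  exact measurableSet_le ((measurable_largeCount_real r).add_const _) measurable_const

theorem largeCount_le {p : ℕ} (r : ℝ) (β : Fin p → ℝ) : largeCount r β ≤ p :=
  (Finset.card_le_univ _).trans_eq (Fintype.card_fin p)

instance isProbabilityMeasure_studentPrior {p : ℕ} {a b : ℝ} [ha : Fact (0 < a)]
    [hb : Fact (0 < b)] : IsProbabilityMeasure (studentPrior p a b) := by
  have := isProbabilityMeasure_studentT ha.out hb.out 0
  unfold studentPrior
  infer_instance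

/-- Exponential moment of the number of large coordinates under the prior. -/
theorem lintegral_exp_largeCount_le {p : ℕ} (hp : 0 < p) {a b r c : ℝ} (ha : 0 < a) (hb : 0 < b)
    (htail : studentT 0 a b {x | r < |x|} ≤ ENNReal.ofReal (Real.exp (-c) / p)) :
    ∫⁻ β, ENNReal.ofReal (Real.exp (c * largeCount r β)) ∂(studentPrior p a b)
      ≤ ENNReal.ofReal (Real.exp 1) := by
  have := isProbabilityMeasure_studentT ha hb 0
  have hp' : (0 : ℝ) < p := by exact_mod_cast hp
  set B := {x : ℝ | r < |x|} with hB
  have h1 : ∀ β : Fin p → ℝ, ENNReal.ofReal (Real.exp (c * largeCount r β))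
      = ∏ j, ENNReal.ofReal (Real.exp (c * B.indicator (fun _ => (1 : ℝ)) (β j))) := by
    intro β
    rw [← ENNReal.ofReal_prod_of_nonneg fun i _ => (Real.exp_pos _).le, ← Real.exp_sum,
      ← Finset.mul_sum, largeCount_eq_sum]
  have hf : Measurable fun x : ℝ =>
      ENNReal.ofReal (Real.exp (c * B.indicator (fun _ => (1 : ℝ)) x)) :=
    (((measurable_const.indicator (measurableSet_lt_abs r)).const_mul c).exp).ennreal_ofReal
  simp_rw [h1]
  rw [studentPrior, lintegral_pi_prod (fun _ : Fin p => studentT 0 a b) fun _ => hf,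
    Finset.prod_const, Finset.card_univ, Fintype.card_fin]
  -- One coordinate contributes at most `1 + exp c * (exp (-c) / p) = 1 + 1 / p ≤ exp (1 / p)`, so
  -- the `p`-fold product is at most `exp 1`.
  have h2 : ∫⁻ x, ENNReal.ofReal (Real.exp (c * B.indicator (fun _ => (1 : ℝ)) x))
      ∂(studentT 0 a b) ≤ ENNReal.ofReal (Real.exp (1 / p)) := by
    calc ∫⁻ x, ENNReal.ofReal (Real.exp (c * B.indicator (fun _ => (1 : ℝ)) x)) ∂(studentT 0 a b)
        ≤ ∫⁻ x, (1 + B.indicator (fun _ => ENNReal.ofReal (Real.exp c)) x) ∂(studentT 0 a b) := by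
          refine lintegral_mono fun x => ?_
          by_cases hx : x ∈ B
          · simp [Set.indicator_of_mem hx]
          · simp [Set.indicator_of_notMem hx]
      _ = 1 + ENNReal.ofReal (Real.exp c) * studentT 0 a b B := by
          rw [lintegral_add_left measurable_const,
            lintegral_indicator_const (measurableSet_lt_abs r), lintegral_one, measure_univ]
      _ ≤ 1 + ENNReal.ofReal (Real.exp c) * ENNReal.ofReal (Real.exp (-c) / p) := by gcongr
      _ = ENNReal.ofReal (1 + 1 / p) := by
          rw [← ENNReal.ofReal_mul (Real.exp_pos _).le, ENNReal.ofReal_add zero_le_one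
            (by positivity), ENNReal.ofReal_one, mul_div_assoc', ← Real.exp_add]
          simp
      _ ≤ _ := ENNReal.ofReal_le_ofReal (by
          have := Real.add_one_le_exp (1 / (p : ℝ)); linarith)
  calc _ ≤ ENNReal.ofReal (Real.exp (1 / p)) ^ p := by gcongr
    _ = ENNReal.ofReal (Real.exp 1) := by
        rw [← ENNReal.ofReal_pow (Real.exp_pos _).le, ← Real.exp_nat_mul]
        congr 2
        field_simp

/-! ### The test function, its evidence and the noise event. -/

/-- The signal, shrunk by the factor `1 - θ` at vectors with few large coordinates. -/
noncomputable def shrunkSignal {n p : ℕ} (X : Matrix (Fin n) (Fin p) ℝ) (σ : ℝ) (β₀ : Fin p → ℝ)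
    (θ r : ℝ) (s m : ℕ) (β : Fin p → ℝ) : Fin n → ℝ :=
  (if largeCount r β + s ≤ m then 1 - θ else 1) • signal X σ β₀ β

theorem measurable_shrunkSignal {n p : ℕ} (X : Matrix (Fin n) (Fin p) ℝ) (σ : ℝ)
    (β₀ : Fin p → ℝ) (θ r : ℝ) (s m : ℕ) : Measurable (shrunkSignal X σ β₀ θ r s m) := by
  have h : Measurable fun β : Fin p → ℝ => if largeCount r β + s ≤ m then 1 - θ else 1 :=
    Measurable.ite (measurableSet_largeCount_add_le r s m) measurable_const measurable_const
  exact h.smul (measurable_signal X σ β₀)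

/-- The Donsker--Varadhan test function: a penalty on the number of large coordinates plus the
log-likelihood ratio of the (shrunk) signal. -/
noncomputable def score {n p : ℕ} (X : Matrix (Fin n) (Fin p) ℝ) (σ : ℝ) (β₀ : Fin p → ℝ)
    (θ r c : ℝ) (s m : ℕ) (e : Fin n → ℝ) (β : Fin p → ℝ) : ℝ :=
  c * largeCount r β + (shrunkSignal X σ β₀ θ r s m β ⬝ᵥ e
    - shrunkSignal X σ β₀ θ r s m β ⬝ᵥ shrunkSignal X σ β₀ θ r s m β / 2)

theorem measurable_score {n p : ℕ} (X : Matrix (Fin n) (Fin p) ℝ) (σ : ℝ) (β₀ : Fin p → ℝ)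
    (θ r c : ℝ) (s m : ℕ) :
    Measurable fun z : (Fin n → ℝ) × (Fin p → ℝ) => score X σ β₀ θ r c s m z.1 z.2 := by
  have hw : Measurable fun z : (Fin n → ℝ) × (Fin p → ℝ) => shrunkSignal X σ β₀ θ r s m z.2 :=
    (measurable_shrunkSignal X σ β₀ θ r s m).comp measurable_snd
  exact (((measurable_largeCount_real r).comp measurable_snd).const_mul c).add
    ((measurable_dotProduct hw measurable_fst).sub ((measurable_dotProduct hw hw).div_const 2))

/-- The integrated exponential score. -/
noncomputable def evidence {n p : ℕ} (X : Matrix (Fin n) (Fin p) ℝ) (σ : ℝ) (β₀ : Fin p → ℝ)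
    (θ r c : ℝ) (s m : ℕ) (π : Measure (Fin p → ℝ)) (e : Fin n → ℝ) : ℝ≥0∞ :=
  ∫⁻ β, ENNReal.ofReal (Real.exp (score X σ β₀ θ r c s m e β)) ∂π

theorem measurable_evidence {n p : ℕ} (X : Matrix (Fin n) (Fin p) ℝ) (σ : ℝ) (β₀ : Fin p → ℝ)
    (θ r c : ℝ) (s m : ℕ) (π : Measure (Fin p → ℝ)) [SFinite π] :
    Measurable (evidence X σ β₀ θ r c s m π) :=
  (measurable_score X σ β₀ θ r c s m).exp.ennreal_ofReal.lintegral_prod_right'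

/-- For each fixed `β` the Gaussian factor has noise mean one, whether the signal is shrunk or not,
so only the penalty survives Fubini. -/
theorem lintegral_evidence {n p : ℕ} (X : Matrix (Fin n) (Fin p) ℝ) (σ : ℝ) (β₀ : Fin p → ℝ)
    (θ r c : ℝ) (s m : ℕ) (π : Measure (Fin p → ℝ)) [SFinite π] :
    ∫⁻ e, evidence X σ β₀ θ r c s m π e ∂(Measure.pi fun _ : Fin n => gaussianReal 0 1)
      = ∫⁻ β, ENNReal.ofReal (Real.exp (c * largeCount r β)) ∂π := by
  unfold evidence
  rw [lintegral_lintegral_swap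
    (measurable_score X σ β₀ θ r c s m).exp.ennreal_ofReal.aemeasurable]
  refine lintegral_congr fun β => ?_
  simp only [score, Real.exp_add, ENNReal.ofReal_mul (Real.exp_pos _).le]
  have hm : Measurable fun e : Fin n → ℝ => ENNReal.ofReal (Real.exp
      (shrunkSignal X σ β₀ θ r s m β ⬝ᵥ e
        - shrunkSignal X σ β₀ θ r s m β ⬝ᵥ shrunkSignal X σ β₀ θ r s m β / 2)) :=
    ((measurable_dotProduct measurable_const measurable_id).sub_const _).exp.ennreal_ofReal
  rw [lintegral_const_mul _ hm, lintegral_exp_dotProduct_gaussian, mul_one]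

/-- The exponential martingale `exp (w · e - |w|² / 2)`. -/
noncomputable def gaussianExp {n : ℕ} (w e : Fin n → ℝ) : ℝ≥0∞ :=
  ENNReal.ofReal (Real.exp (w ⬝ᵥ e - w ⬝ᵥ w / 2))

theorem measurable_gaussianExp {n : ℕ} (w : Fin n → ℝ) : Measurable (gaussianExp w) :=
  ((measurable_dotProduct measurable_const measurable_id).sub_const _).exp.ennreal_ofReal

/-- The sum of the two-sided exponential martingales along the columns of the design. -/
noncomputable def columnExpSum {n p : ℕ} (X : Matrix (Fin n) (Fin p) ℝ) (t : ℝ)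
    (e : Fin n → ℝ) : ℝ≥0∞ :=
  ∑ j, (gaussianExp (t • X.col j) e + gaussianExp ((-t) • X.col j) e)

theorem measurable_columnExpSum {n p : ℕ} (X : Matrix (Fin n) (Fin p) ℝ) (t : ℝ) :
    Measurable (columnExpSum X t) :=
  Finset.measurable_fun_sum _ fun _ _ => (measurable_gaussianExp _).add (measurable_gaussianExp _)

theorem lintegral_columnExpSum {n p : ℕ} (X : Matrix (Fin n) (Fin p) ℝ) (t : ℝ) :
    ∫⁻ e, columnExpSum X t e ∂(Measure.pi fun _ : Fin n => gaussianReal 0 1) = 2 * p := by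
  have h1 : ∀ w : Fin n → ℝ,
      ∫⁻ e, gaussianExp w e ∂(Measure.pi fun _ : Fin n => gaussianReal 0 1) = 1 :=
    lintegral_exp_dotProduct_gaussian
  unfold columnExpSum
  rw [lintegral_finsetSum]
  · simp_rw [lintegral_add_left (measurable_gaussianExp _), h1, one_add_one_eq_two]
    simp [mul_comm]
  · exact fun j _ => (measurable_gaussianExp _).add (measurable_gaussianExp _)

/-- With `t² n = L`, each summand being at most `exp (2 L)` gives `± t (Xᵀ e)_j ≤ 2 L + L / 2`;
dividing by `t` yields the factor `5 / 2`. -/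
theorem abs_transpose_mulVec_le_of_columnExpSum {n p : ℕ} {X : Matrix (Fin n) (Fin p) ℝ}
    (hcol : ∀ j, ∑ i, X i j ^ 2 ≤ (n : ℝ)) {L : ℝ} (hn : 0 < n) (hL : 0 < L) {e : Fin n → ℝ}
    (he : columnExpSum X √(L / n) e ≤ ENNReal.ofReal (Real.exp (2 * L))) (j : Fin p) :
    |(Xᵀ *ᵥ e) j| ≤ 5 / 2 * √(n * L) := by
  have hn' : (0 : ℝ) < n := by exact_mod_cast hn
  set t := √(L / n) with ht
  have ht0 : 0 < t := Real.sqrt_pos.2 (by positivity)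
  have ht2 : t ^ 2 * n = L := by rw [ht, Real.sq_sqrt (by positivity)]; field_simp
  have hnorm : ∀ u : ℝ, (u • X.col j) ⬝ᵥ (u • X.col j) ≤ u ^ 2 * n := by
    intro u
    have : (u • X.col j) ⬝ᵥ (u • X.col j) = u ^ 2 * ∑ i, X i j ^ 2 := by
      simp only [dotProduct, Pi.smul_apply, Matrix.col_apply, smul_eq_mul, Finset.mul_sum]
      exact Finset.sum_congr rfl fun i _ => by ring
    rw [this]
    have := hcol j
    gcongr
  have hexp : ∀ u : ℝ, gaussianExp (u • X.col j) e ≤ ENNReal.ofReal (Real.exp (2 * L)) → u ^ 2 = t ^ 2 →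
      u * (Xᵀ *ᵥ e) j ≤ 5 / 2 * L := by
    intro u hu hut
    have h1 := Real.exp_le_exp.1 ((ENNReal.ofReal_le_ofReal_iff (Real.exp_pos _).le).1 hu)
    have h2 := hnorm u
    rw [hut, ht2] at h2
    have h3 : (u • X.col j) ⬝ᵥ e = u * (Xᵀ *ᵥ e) j := by
      rw [smul_dotProduct, smul_eq_mul]; rfl
    linarith
  have hj := (Finset.single_le_sum (f := fun j =>
    gaussianExp (t • X.col j) e + gaussianExp ((-t) • X.col j) e)
    (fun _ _ => zero_le) (Finset.mem_univ j)).trans he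
  have h1 := hexp t (le_self_add.trans hj) rfl
  have h2 := hexp (-t) (le_add_self.trans hj) (by ring)
  have hsqrt : √(n * L) * t = L := by
    rw [ht, ← Real.sqrt_mul (by positivity), show (n : ℝ) * L * (L / n) = L * L by field_simp,
      Real.sqrt_mul_self hL.le]
  refine le_of_mul_le_mul_right ?_ ht0
  rw [mul_assoc, hsqrt]
  rcases abs_cases ((Xᵀ *ᵥ e) j) with ⟨h, _⟩ | ⟨h, _⟩ <;> rw [h] <;> linarith

/-- The good noise event: no column correlates strongly with the noise, and the evidence is not
too large. -/
def noiseEvent {n p : ℕ} (X : Matrix (Fin n) (Fin p) ℝ) (σ : ℝ) (β₀ : Fin p → ℝ)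
    (θ r c : ℝ) (s m : ℕ) (π : Measure (Fin p → ℝ)) (L : ℝ) : Set (Fin n → ℝ) :=
  {e | columnExpSum X √(L / n) e ≤ ENNReal.ofReal (Real.exp (2 * L)) ∧
    evidence X σ β₀ θ r c s m π e ≤ ENNReal.ofReal (Real.exp (s * L))}

theorem measurableSet_noiseEvent {n p : ℕ} (X : Matrix (Fin n) (Fin p) ℝ) (σ : ℝ)
    (β₀ : Fin p → ℝ) (θ r c : ℝ) (s m : ℕ) (π : Measure (Fin p → ℝ)) [SFinite π] (L : ℝ) :
    MeasurableSet (noiseEvent X σ β₀ θ r c s m π L) :=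
  (measurableSet_le (measurable_columnExpSum X _) measurable_const).inter
    (measurableSet_le (measurable_evidence X σ β₀ θ r c s m π) measurable_const)

theorem measure_gt_ofReal_exp_le {α : Type*} [MeasurableSpace α] {μ : Measure α}
    {f : α → ℝ≥0∞} (hf : Measurable f) (u : ℝ) :
    μ {x | ¬ f x ≤ ENNReal.ofReal (Real.exp u)}
      ≤ ENNReal.ofReal (Real.exp (-u)) * ∫⁻ x, f x ∂μ := by
  have h := mul_meas_ge_le_lintegral (μ := μ) hf (ENNReal.ofReal (Real.exp u))
  have hsub : {x | ¬ f x ≤ ENNReal.ofReal (Real.exp u)} ⊆ {x | ENNReal.ofReal (Real.exp u) ≤ f x} :=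
    fun x hx => (not_le.1 hx).le
  calc μ {x | ¬ f x ≤ ENNReal.ofReal (Real.exp u)}
      = ENNReal.ofReal (Real.exp (-u)) * (ENNReal.ofReal (Real.exp u)
          * μ {x | ¬ f x ≤ ENNReal.ofReal (Real.exp u)}) := by
        rw [← mul_assoc, ← ENNReal.ofReal_mul (Real.exp_pos _).le, ← Real.exp_add]
        simp
    _ ≤ _ := by
        gcongr
        exact (mul_le_mul_right (measure_mono hsub) _).trans h

/-- Markov's inequality twice: the column sum has mean `2 p ≤ 2 exp L` against the level `exp (2
L)`, and the evidence has mean at most `exp 1` against `exp (s L)` with `s ≥ 1`. -/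
theorem measure_compl_noiseEvent_le {n p : ℕ} (X : Matrix (Fin n) (Fin p) ℝ) (σ : ℝ)
    (β₀ : Fin p → ℝ) (θ : ℝ) {r c : ℝ} {s : ℕ} (m : ℕ) {a b L : ℝ} (hp : 0 < p)
    (ha : 0 < a) (hb : 0 < b) (hs : 1 ≤ s) (hL : 0 ≤ L) (hpL : (p : ℝ) ≤ Real.exp L)
    (htail : studentT 0 a b {x | r < |x|} ≤ ENNReal.ofReal (Real.exp (-c) / p)) :
    (Measure.pi fun _ : Fin n => gaussianReal 0 1)
        (noiseEvent X σ β₀ θ r c s m (studentPrior p a b) L)ᶜ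
      ≤ ENNReal.ofReal ((2 + Real.exp 1) * Real.exp (-L)) := by
  have : Fact (0 < a) := ⟨ha⟩
  have : Fact (0 < b) := ⟨hb⟩
  set P := Measure.pi fun _ : Fin n => gaussianReal 0 1
  have hs' : (1 : ℝ) ≤ s := by exact_mod_cast hs
  have h1 := measure_gt_ofReal_exp_le (μ := P) (measurable_columnExpSum X √(L / n)) (2 * L)
  have h2 := measure_gt_ofReal_exp_le (μ := P)
    (measurable_evidence X σ β₀ θ r c s m (studentPrior p a b)) (s * L)
  rw [lintegral_columnExpSum] at h1
  rw [lintegral_evidence] at h2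
  have hsub : (noiseEvent X σ β₀ θ r c s m (studentPrior p a b) L)ᶜ
      ⊆ {e | ¬ columnExpSum X √(L / n) e ≤ ENNReal.ofReal (Real.exp (2 * L))}
        ∪ {e | ¬ evidence X σ β₀ θ r c s m (studentPrior p a b) e
          ≤ ENNReal.ofReal (Real.exp (s * L))} := by
    intro e he
    by_contra hcon
    simp only [Set.mem_union, Set.mem_ofPred_eq, not_or, not_not] at hcon
    exact he hcon
  have h3 : ENNReal.ofReal (Real.exp (-(2 * L))) * (2 * p)
      ≤ ENNReal.ofReal (2 * Real.exp (-L)) := by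
    have e1 : (2 * p : ℝ≥0∞) = ENNReal.ofReal (2 * p) := by
      rw [ENNReal.ofReal_mul zero_le_two]; simp
    rw [e1, ← ENNReal.ofReal_mul (Real.exp_pos _).le]
    refine ENNReal.ofReal_le_ofReal ?_
    calc Real.exp (-(2 * L)) * (2 * p) ≤ Real.exp (-(2 * L)) * (2 * Real.exp L) := by gcongr
      _ = 2 * Real.exp (-L) := by
        rw [mul_left_comm, ← Real.exp_add]; ring_nf
  have h4 : ENNReal.ofReal (Real.exp (-(s * L)))
        * ∫⁻ β, ENNReal.ofReal (Real.exp (c * largeCount r β)) ∂(studentPrior p a b)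
      ≤ ENNReal.ofReal (Real.exp 1 * Real.exp (-L)) := by
    calc _ ≤ ENNReal.ofReal (Real.exp (-L)) * ENNReal.ofReal (Real.exp 1) := by
          gcongr
          · nlinarith
          · exact lintegral_exp_largeCount_le hp ha hb htail
      _ = _ := by rw [← ENNReal.ofReal_mul (Real.exp_pos _).le, mul_comm]
  refine (measure_mono hsub).trans ((measure_union_le _ _).trans ?_)
  rw [add_mul, ENNReal.ofReal_add (by positivity) (by positivity)]
  exact add_le_add (h1.trans h3) (h2.trans h4)

/-! ### Bounds on the negative ELBO and integrability. -/

theorem baseline_add_eq {n p : ℕ} (X : Matrix (Fin n) (Fin p) ℝ) (σ : ℝ) (β₀ β : Fin p → ℝ)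
    (y : Fin n → ℝ) :
    baseline X σ β₀ y
      + (signal X σ β₀ β ⬝ᵥ signal X σ β₀ β / 2 - signal X σ β₀ β ⬝ᵥ stdResidual X σ β₀ y)
      = n * Real.log (√(2 * Real.pi * σ ^ 2))
        + (stdResidual X σ β₀ y - signal X σ β₀ β) ⬝ᵥ
          (stdResidual X σ β₀ y - signal X σ β₀ β) / 2 := by
  rw [baseline, sub_dotProduct, dotProduct_sub, dotProduct_sub,
    dotProduct_comm (stdResidual X σ β₀ y) (signal X σ β₀ β)]
  ring

theorem dotProduct_self_nonneg_real {n : ℕ} (w : Fin n → ℝ) : 0 ≤ w ⬝ᵥ w :=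
  Finset.sum_nonneg fun _ _ => mul_self_nonneg _

theorem two_mul_abs_dotProduct_le {n : ℕ} (v w : Fin n → ℝ) :
    2 * |v ⬝ᵥ w| ≤ v ⬝ᵥ v + w ⬝ᵥ w := by
  have h1 := dotProduct_self_nonneg_real (v - w)
  have h2 := dotProduct_self_nonneg_real (v + w)
  rw [sub_dotProduct, dotProduct_sub, dotProduct_sub, dotProduct_comm w v] at h1
  rw [add_dotProduct, dotProduct_add, dotProduct_add, dotProduct_comm w v] at h2
  rcases abs_cases (v ⬝ᵥ w) with ⟨h, _⟩ | ⟨h, _⟩ <;> rw [h] <;> linarith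

theorem neg_log_likelihood_ge {n p : ℕ} (X : Matrix (Fin n) (Fin p) ℝ) {σ : ℝ} (hσ : 0 < σ)
    (y : Fin n → ℝ) (β : Fin p → ℝ) :
    n * Real.log (√(2 * Real.pi * σ ^ 2)) ≤ -Real.log (likelihood X σ y β) := by
  rw [neg_log_likelihood X hσ 0, baseline_add_eq]
  have := dotProduct_self_nonneg_real (stdResidual X σ 0 y - signal X σ 0 β)
  linarith

theorem measurable_neg_log_likelihood {n p : ℕ} (X : Matrix (Fin n) (Fin p) ℝ) {σ : ℝ}
    (hσ : 0 < σ) (y : Fin n → ℝ) : Measurable fun β => -Real.log (likelihood X σ y β) := by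
  simp_rw [neg_log_likelihood X hσ 0]
  have h := measurable_signal X σ (0 : Fin p → ℝ)
  exact (((measurable_dotProduct h h).div_const 2).sub
    (measurable_dotProduct h measurable_const)).const_add _

theorem isProbabilityMeasure_of_mem_variationalFamily {p : ℕ} {q : Measure (Fin p → ℝ)}
    (hq : q ∈ variationalFamily p) : IsProbabilityMeasure q := by
  obtain ⟨m, a, b, ha, hb, rfl⟩ := hq
  have := fun j => isProbabilityMeasure_studentT (ha j) (hb j) (m j)
  infer_instance

/-- Total variance of a product of Student laws about its location. -/
theorem lintegral_sum_sq_sub_studentT {p : ℕ} {a b : ℝ} (ha : 1 < a) (hb : 0 < b)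
    (m : Fin p → ℝ) :
    ∫⁻ β, ENNReal.ofReal (∑ j, (β j - m j) ^ 2) ∂(Measure.pi fun j => studentT (m j) a b)
      = ENNReal.ofReal (p * (b / (a - 1))) := by
  have := fun j => isProbabilityMeasure_studentT (by linarith) hb (m j) (a := a)
  simp_rw [ENNReal.ofReal_sum_of_nonneg fun j _ => sq_nonneg _]
  rw [lintegral_finsetSum _ fun j _ => by fun_prop]
  have h1 : ∀ j, ∫⁻ β, ENNReal.ofReal ((β j - m j) ^ 2)
      ∂(Measure.pi fun j => studentT (m j) a b) = ENNReal.ofReal (b / (a - 1)) := fun j => by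
    rw [← lintegral_sq_sub_studentT ha hb (m j)]
    exact (measurePreserving_eval (fun j => studentT (m j) a b) j).lintegral_comp
      (f := fun x => ENNReal.ofReal ((x - m j) ^ 2)) (by fun_prop)
  simp_rw [h1]
  rw [Finset.sum_const, Finset.card_univ, Fintype.card_fin, nsmul_eq_mul,
    ENNReal.ofReal_mul (Nat.cast_nonneg p), ENNReal.ofReal_natCast]

/-- Relative entropy of the prior shifted to `β₀` with respect to the prior. -/
theorem klDiv_shifted_studentPrior_le {p : ℕ} {a b D : ℝ} (ha : 0 < a) (hb : 0 < b)
    (β₀ : Fin p → ℝ)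
    (hD : ∀ j, β₀ j ≠ 0 → (a + 1 / 2) * Real.log (2 + β₀ j ^ 2 / b) ≤ D) :
    InformationTheory.klDiv (Measure.pi fun j => studentT (β₀ j) a b) (studentPrior p a b)
      ≤ ENNReal.ofReal (sparsity β₀ * D) := by
  have h1 := fun j => isProbabilityMeasure_studentT ha hb (β₀ j)
  have h0 := isProbabilityMeasure_studentT ha hb 0
  have : Fact (0 < a) := ⟨ha⟩
  have : Fact (0 < b) := ⟨hb⟩
  -- At a zero coefficient the shifted and the original prior coordinate agree, so the constant is
  -- `1` and its logarithm costs nothing.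
  set c : Fin p → ℝ := fun j => if β₀ j ≠ 0 then (2 + β₀ j ^ 2 / b) ^ (a + 1 / 2) else 1 with hc
  have hc0 : ∀ j, 0 < c j := fun j => by
    simp only [hc]
    split_ifs <;> positivity
  have hle : ∀ j, studentT (β₀ j) a b ≤ ENNReal.ofReal (c j) • studentT 0 a b := fun j => by
    by_cases h : β₀ j = 0
    · simp [hc, h]
    · simp only [hc, ne_eq, h, not_false_eq_true, if_true]
      exact studentT_le_smul ha hb (β₀ j)
  have hpi := pi_le_smul_pi hle
  rw [← ENNReal.ofReal_prod_of_nonneg fun j _ => (hc0 j).le] at hpi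
  refine (klDiv_le_log_of_le_smul (Finset.prod_pos fun j _ => hc0 j) hpi).trans
    (ENNReal.ofReal_le_ofReal ?_)
  rw [Real.log_prod fun j _ => (hc0 j).ne', sparsity, Finset.card_filter]
  push_cast
  rw [Finset.sum_mul]
  refine Finset.sum_le_sum fun j _ => ?_
  by_cases h : β₀ j = 0
  · simp [hc, h]
  · simp only [hc, ne_eq, h, not_false_eq_true, if_true, one_mul]
    rw [Real.log_rpow (by positivity)]
    exact hD j h

/-- The prior shifted to the true coefficient vector has a small negative ELBO. -/
theorem negELBO_shifted_studentPrior_le {n p : ℕ} {X : Matrix (Fin n) (Fin p) ℝ}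
    (hcol : ∀ j, ∑ i, X i j ^ 2 ≤ (n : ℝ)) {σ L τ a b D : ℝ} (hn : 0 < n) (hσ : 0 < σ)
    (ha : 1 < a) (hb : 0 < b) (β₀ : Fin p → ℝ) (y : Fin n → ℝ)
    (he : ∀ j, |(Xᵀ *ᵥ stdResidual X σ β₀ y) j| ≤ τ) (hτ : τ ^ 2 ≤ 25 / 4 * (n * L))
    (hD0 : 0 ≤ D) (hD : ∀ j, β₀ j ≠ 0 → (a + 1 / 2) * Real.log (2 + β₀ j ^ 2 / b) ≤ D) :
    negELBO X σ a b y (Measure.pi fun j => studentT (β₀ j) a b)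
      ≤ ((baseline X σ β₀ y + ((σ⁻¹ ^ 2 / 2 + σ⁻¹ / 2) * (n * p) * (p * (b / (a - 1)))
        + 25 / 8 * σ⁻¹ * L + sparsity β₀ * D) : ℝ) : EReal) := by
  have hprob := fun j => isProbabilityMeasure_studentT (by linarith) hb (β₀ j) (a := a)
  set q := Measure.pi fun j => studentT (β₀ j) a b with hq
  set V : (Fin p → ℝ) → ℝ := fun β => ∑ j, (β j - β₀ j) ^ 2 with hV
  have hV0 : ∀ β, 0 ≤ V β := fun β => Finset.sum_nonneg fun _ _ => sq_nonneg _
  have hVm : Measurable V := by fun_prop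
  have hba : 0 ≤ p * (b / (a - 1)) := by
    have : 0 < a - 1 := by linarith
    positivity
  have hVl := lintegral_sum_sq_sub_studentT ha hb β₀
  have hVi : Integrable V q := by
    refine ⟨hVm.aestronglyMeasurable, ?_⟩
    rw [hasFiniteIntegral_iff_ofReal (ae_of_all _ hV0), hVl]
    exact ENNReal.ofReal_lt_top
  have hVint : ∫ β, V β ∂q = p * (b / (a - 1)) := by
    rw [integral_eq_lintegral_of_nonneg_ae (ae_of_all _ hV0) hVm.aestronglyMeasurable, hVl,
      ENNReal.toReal_ofReal hba]
  set B := baseline X σ β₀ y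
  set k := (σ⁻¹ ^ 2 / 2 + σ⁻¹ / 2) * (n * p : ℝ)
  set f := fun β => -Real.log (likelihood X σ y β) with hf
  have hup : ∀ β, f β ≤ k * V β + (B + 25 / 8 * σ⁻¹ * L) := fun β => by
    have h1 : signal X σ β₀ β ⬝ᵥ signal X σ β₀ β / 2 - signal X σ β₀ β ⬝ᵥ stdResidual X σ β₀ y
        ≤ k * V β + 25 / 8 * σ⁻¹ * L :=
      signal_sub_cross_le hcol hn hσ β₀ β (stdResidual X σ β₀ y) he hτ
    have h2 : f β = B + _ := neg_log_likelihood X hσ β₀ β y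
    linarith
  have hbd : Integrable (fun β => k * V β + (B + 25 / 8 * σ⁻¹ * L)) q :=
    (hVi.const_mul k).add (integrable_const _)
  have hfi : Integrable f q := by
    refine (hbd.abs.add (integrable_const |n * Real.log (√(2 * Real.pi * σ ^ 2))|)).mono'
      (measurable_neg_log_likelihood X hσ y).aestronglyMeasurable (ae_of_all _ fun β => ?_)
    have h1 := neg_log_likelihood_ge X hσ y β
    have h2 := hup β
    rw [Real.norm_eq_abs]
    refine abs_le.2 ⟨?_, ?_⟩
    · have h3 := neg_abs_le (n * Real.log (√(2 * Real.pi * σ ^ 2)))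
      have h4 := abs_nonneg (k * V β + (B + 25 / 8 * σ⁻¹ * L))
      simp only [Pi.add_apply]
      linarith
    · have h3 := abs_nonneg (n * Real.log (√(2 * Real.pi * σ ^ 2)))
      have h4 := le_abs_self (k * V β + (B + 25 / 8 * σ⁻¹ * L))
      simp only [Pi.add_apply]
      linarith
  have hfint : ∫ β, f β ∂q ≤ k * (p * (b / (a - 1))) + (B + 25 / 8 * σ⁻¹ * L) := by
    refine (integral_mono hfi hbd hup).trans (le_of_eq ?_)
    rw [integral_add (hVi.const_mul k) (integrable_const _), integral_const_mul, hVint]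
    simp
  have hkl : ((InformationTheory.klDiv q (studentPrior p a b) : ℝ≥0∞) : EReal)
      ≤ ((sparsity β₀ * D : ℝ) : EReal) := by
    have h := klDiv_shifted_studentPrior_le (by linarith) hb β₀ hD
    have h' := EReal.coe_ennreal_le_coe_ennreal_iff.2 h
    rwa [EReal.coe_ennreal_ofReal, max_eq_left (by positivity)] at h'
  rw [negELBO, extExpectation_of_integrable hfi]
  refine (add_le_add (EReal.coe_le_coe_iff.2 hfint) hkl).trans (le_of_eq ?_)
  rw [← EReal.coe_add]
  congr 1
  ring

/-- A law with finite negative ELBO has an integrable log-likelihood and finite relative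
entropy. -/
theorem integrable_and_klDiv_ne_top_of_negELBO {n p : ℕ} {X : Matrix (Fin n) (Fin p) ℝ}
    {σ a b : ℝ} (hσ : 0 < σ) {y : Fin n → ℝ} {q : Measure (Fin p → ℝ)} [IsProbabilityMeasure q]
    (h : negELBO X σ a b y q ≠ ⊤) :
    Integrable (fun β => -Real.log (likelihood X σ y β)) q ∧
      InformationTheory.klDiv q (studentPrior p a b) ≠ ∞ := by
  have hint : Integrable (fun β => -Real.log (likelihood X σ y β)) q := by
    refine integrable_of_extExpectation_ne_top (measurable_neg_log_likelihood X hσ y)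
      (neg_log_likelihood_ge X hσ y) fun htop => h ?_
    rw [negELBO, htop]
    exact EReal.top_add_of_ne_bot (EReal.coe_ennreal_ne_bot _)
  refine ⟨hint, fun htop => h ?_⟩
  rw [negELBO, htop, extExpectation_of_integrable hint, EReal.coe_ennreal_top, EReal.coe_add_top]

theorem shrunkSignal_dotProduct_self_le {n p : ℕ} (X : Matrix (Fin n) (Fin p) ℝ) (σ : ℝ)
    (β₀ : Fin p → ℝ) {θ : ℝ} (r : ℝ) (s m : ℕ) (hθ0 : 0 ≤ θ) (hθ1 : θ ≤ 1) (β : Fin p → ℝ) :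
    shrunkSignal X σ β₀ θ r s m β ⬝ᵥ shrunkSignal X σ β₀ θ r s m β
      ≤ signal X σ β₀ β ⬝ᵥ signal X σ β₀ β := by
  have h := dotProduct_self_nonneg_real (signal X σ β₀ β)
  rw [shrunkSignal, smul_dotProduct, dotProduct_smul, smul_eq_mul, smul_eq_mul]
  split_ifs
  · nlinarith [mul_nonneg (mul_nonneg hθ0 (by linarith : 0 ≤ 2 - θ)) h]
  · linarith

/-- The residual square controls the signal: `|v|² ≤ 2 |e - v|² + 2 |e|²`. Integrability of the
log-likelihood thus passes to `|v|²`, hence to every term of the score. -/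
theorem integrable_score {n p : ℕ} (X : Matrix (Fin n) (Fin p) ℝ) {σ θ : ℝ} (hσ : 0 < σ)
    (β₀ : Fin p → ℝ) (r c : ℝ) (s m : ℕ) (y : Fin n → ℝ) (hθ0 : 0 ≤ θ) (hθ1 : θ ≤ 1)
    {q : Measure (Fin p → ℝ)} [IsProbabilityMeasure q]
    (hint : Integrable (fun β => -Real.log (likelihood X σ y β)) q) :
    Integrable (score X σ β₀ θ r c s m (stdResidual X σ β₀ y)) q := by
  have hgm : Measurable (score X σ β₀ θ r c s m (stdResidual X σ β₀ y)) :=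
    (measurable_score X σ β₀ θ r c s m).of_uncurry_left
  set f := fun β => -Real.log (likelihood X σ y β) with hf
  have hfeq : ∀ β, f β = n * Real.log (√(2 * Real.pi * σ ^ 2))
      + (stdResidual X σ β₀ y - signal X σ β₀ β) ⬝ᵥ
        (stdResidual X σ β₀ y - signal X σ β₀ β) / 2 := fun β =>
    (neg_log_likelihood X hσ β₀ β y).trans (baseline_add_eq X σ β₀ β y)
  have hw := shrunkSignal_dotProduct_self_le X σ β₀ r s m hθ0 hθ1
  unfold score at hgm ⊢
  clear_value f
  generalize stdResidual X σ β₀ y = e at *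
  generalize signal X σ β₀ = v at *
  generalize shrunkSignal X σ β₀ θ r s m = w at *
  generalize n * Real.log (√(2 * Real.pi * σ ^ 2)) = c₀ at *
  have hvv : ∀ β, v β ⬝ᵥ v β ≤ 4 * (f β - c₀) + 2 * (e ⬝ᵥ e) := fun β => by
    have h1 := hfeq β
    have h2 := dotProduct_self_nonneg_real (e - (v β - e))
    have h3 : v β ⬝ᵥ v β = 2 * ((e - v β) ⬝ᵥ (e - v β)) + 2 * (e ⬝ᵥ e)
        - (e - (v β - e)) ⬝ᵥ (e - (v β - e)) := by
      simp only [sub_dotProduct, dotProduct_sub, dotProduct_comm e (v β)]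
      ring
    linarith
  have hfc : Integrable (fun β => 4 * (f β - c₀)) q :=
    (hint.sub (integrable_const c₀)).const_mul 4
  have hbd : Integrable (fun β => |c| * p + (4 * (f β - c₀) + 2 * (e ⬝ᵥ e)) + e ⬝ᵥ e / 2) q :=
    ((integrable_const _).add (hfc.add (integrable_const _))).add (integrable_const _)
  refine hbd.mono' hgm.aestronglyMeasurable (ae_of_all _ fun β => ?_)
  have h1 := hvv β
  have h2 := hw β
  have h3 := two_mul_abs_dotProduct_le (w β) e
  have h4 := dotProduct_self_nonneg_real (w β)
  have h5 : |c * largeCount r β| ≤ |c| * p := by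
    rw [abs_mul, Nat.abs_cast]
    have : (largeCount r β : ℝ) ≤ p := by exact_mod_cast largeCount_le r β
    gcongr
  rw [Real.norm_eq_abs]
  calc |c * largeCount r β + (w β ⬝ᵥ e - w β ⬝ᵥ w β / 2)| 
          ≤ |c * largeCount r β| + (|w β ⬝ᵥ e| + |w β ⬝ᵥ w β / 2|) :=
        (abs_add_le _ _).trans (by gcongr; exact abs_sub _ _)
    _ ≤ _ := by
        rw [abs_of_nonneg (show 0 ≤ w β ⬝ᵥ w β / 2 by linarith)]
        linarith
-- Contraction at a fixed sample size.
/-- Markov's inequality for functions dominated by the Donsker--Varadhan gap. -/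
theorem measure_ge_le_of_negELBO_le {n p : ℕ} {X : Matrix (Fin n) (Fin p) ℝ}
    {σ a b θ r c U E d T : ℝ} (hσ : 0 < σ) (ha : 0 < a) (hb : 0 < b) {β₀ : Fin p → ℝ}
    {y : Fin n → ℝ} {s m : ℕ} {q : Measure (Fin p → ℝ)} [IsProbabilityMeasure q]
    (hθ0 : 0 ≤ θ) (hθ1 : θ ≤ 1)
    (hq : negELBO X σ a b y q ≤ ((baseline X σ β₀ y + U : ℝ) : EReal))
    (hev : evidence X σ β₀ θ r c s m (studentPrior p a b) (stdResidual X σ β₀ y)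
      ≤ ENNReal.ofReal (Real.exp E))
    {Z : (Fin p → ℝ) → ℝ} (hZ0 : ∀ β, 0 ≤ Z β)
    (hZ : ∀ β, Z β ≤ score X σ β₀ θ r c s m (stdResidual X σ β₀ y) β
      + (signal X σ β₀ β ⬝ᵥ signal X σ β₀ β / 2 - signal X σ β₀ β ⬝ᵥ stdResidual X σ β₀ y) + d)
    (hT : 0 < T) :
    q {β | T ≤ Z β} ≤ ENNReal.ofReal ((U + E + d) / T) := by
  have : Fact (0 < a) := ⟨ha⟩
  have : Fact (0 < b) := ⟨hb⟩
  have hgm : Measurable (score X σ β₀ θ r c s m (stdResidual X σ β₀ y)) :=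
    (measurable_score X σ β₀ θ r c s m).of_uncurry_left
  set e := stdResidual X σ β₀ y with he
  set v := signal X σ β₀ with hv
  set w := shrunkSignal X σ β₀ θ r s m with hw
  set g := score X σ β₀ θ r c s m e with hg
  set c₀ := n * Real.log (√(2 * Real.pi * σ ^ 2))
  set π := studentPrior p a b
  obtain ⟨hint, hkl⟩ := integrable_and_klDiv_ne_top_of_negELBO (a := a) (b := b) hσ
    (ne_top_of_le_ne_top (EReal.coe_ne_top _) hq)
  set f := fun β => -Real.log (likelihood X σ y β) with hf
  have hfeq : ∀ β, f β = baseline X σ β₀ y + (v β ⬝ᵥ v β / 2 - v β ⬝ᵥ e) :=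
    fun β => neg_log_likelihood X hσ β₀ β y
  have hgi : Integrable g q := integrable_score X hσ β₀ r c s m y hθ0 hθ1 hint
  have hexpm : Measurable fun β => Real.exp (g β) := hgm.exp
  have hexpi : Integrable (fun β => Real.exp (g β)) π := by
    refine ⟨hexpm.aestronglyMeasurable, ?_⟩
    rw [hasFiniteIntegral_iff_ofReal (ae_of_all _ fun _ => (Real.exp_pos _).le)]
    exact hev.trans_lt ENNReal.ofReal_lt_top
  have hlog : Real.log (∫ β, Real.exp (g β) ∂π) ≤ E := by
    rw [Real.log_le_iff_le_exp (integral_exp_pos hexpi),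
      integral_eq_lintegral_of_nonneg_ae (ae_of_all _ fun _ => (Real.exp_pos _).le)
        hexpm.aestronglyMeasurable]
    exact ENNReal.toReal_le_of_le_ofReal (Real.exp_pos _).le hev
  have hdv := integral_le_klDiv_add_log_integral_exp hkl hgi hexpi
  have hsum : ∫ β, f β ∂q + (InformationTheory.klDiv q π).toReal ≤ baseline X σ β₀ y + U := by
    rw [negELBO, extExpectation_of_integrable hint, ← EReal.coe_ennreal_toReal hkl,
      ← EReal.coe_add, EReal.coe_le_coe_iff] at hq
    exact hq
  -- Adding the Donsker–Varadhan bound to the ELBO bound cancels the relative entropy and leaves a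
  -- bound on the `q`-mean of `W`.
  set W := fun β => g β + (f β - baseline X σ β₀ y) + d with hW
  have hZW : ∀ β, Z β ≤ W β := fun β => by
    have h1 := hZ β
    have h2 := hfeq β
    simp only [hW]
    linarith
  have hfi' : Integrable (fun β => f β - baseline X σ β₀ y) q := hint.sub (integrable_const _)
  have hWi : Integrable W q := (hgi.add hfi').add (integrable_const d)
  have hWint : ∫ β, W β ∂q ≤ U + E + d := by
    have h1 : Integrable (fun β => g β + (f β - baseline X σ β₀ y)) q := hgi.add hfi'
    have h2 : ∫ β, W β ∂q = ∫ β, g β ∂q + (∫ β, f β ∂q - baseline X σ β₀ y) + d := by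
      simp only [hW]
      rw [integral_add h1 (integrable_const _), integral_add hgi hfi',
        integral_sub hint (integrable_const _)]
      simp
    linarith
  -- Markov is applied to `W` instead of `Z`, so no measurability of `Z` is needed.
  have hmarkov := mul_meas_ge_le_integral_of_nonneg
    (ae_of_all q fun β => (hZ0 β).trans (hZW β)) hWi T
  rw [← ENNReal.ofReal_toReal (measure_ne_top q {β | T ≤ Z β})]
  refine ENNReal.ofReal_le_ofReal ?_
  rw [le_div_iff₀ hT, mul_comm]
  calc T * (q {β | T ≤ Z β}).toReal ≤ T * q.real {β | T ≤ W β} := by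
        gcongr
        exact measureReal_mono fun β (hβ : T ≤ Z β) => hβ.trans (hZW β)
    _ ≤ _ := hmarkov.trans hWint

/-- The coordinates that are large, or belong to the true support. -/
noncomputable def activeSet {p : ℕ} (r : ℝ) (β₀ β : Fin p → ℝ) : Finset (Fin p) :=
  (Finset.univ.filter fun j => r < |β j|) ∪ Finset.univ.filter fun j => β₀ j ≠ 0

theorem card_activeSet_le {p : ℕ} (r : ℝ) (β₀ β : Fin p → ℝ) :
    (activeSet r β₀ β).card ≤ largeCount r β + sparsity β₀ :=
  Finset.card_union_le _ _

theorem sparsity_le_card_activeSet {p : ℕ} (r : ℝ) (β₀ β : Fin p → ℝ) :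
    sparsity β₀ ≤ (activeSet r β₀ β).card :=
  Finset.card_le_card Finset.subset_union_right

theorem sum_abs_compl_activeSet_le {p : ℕ} {r : ℝ} (hr : 0 ≤ r) (β₀ β : Fin p → ℝ) :
    ∑ j ∈ (activeSet r β₀ β)ᶜ, |(β - β₀) j| ≤ p * r := by
  calc ∑ j ∈ (activeSet r β₀ β)ᶜ, |(β - β₀) j| ≤ ∑ _j ∈ (activeSet r β₀ β)ᶜ, r := by
        refine Finset.sum_le_sum fun j hj => ?_
        have h : |β j| ≤ r ∧ β₀ j = 0 := by simpa [activeSet] using hj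
        simpa [h.2] using h.1
    _ = (activeSet r β₀ β)ᶜ.card * r := by rw [Finset.sum_const, nsmul_eq_mul]
    _ ≤ p * r := by
        have : (activeSet r β₀ β)ᶜ.card ≤ p :=
          (Finset.card_le_univ _).trans_eq (Fintype.card_fin p)
        gcongr

/-- Posterior contraction at a fixed sample size, on the good noise event. -/
theorem measure_norm_ge_le {n p : ℕ} {X : Matrix (Fin n) (Fin p) ℝ}
    (hcol : ∀ j, ∑ i, X i j ^ 2 ≤ (n : ℝ)) {σ lam L a b δ θ U T M : ℝ} {m : ℕ}
    (hn : 0 < n) (hp : 0 < p) (hσ : 0 < σ) (hlam : 0 < lam) (hL : 0 < L) (ha : 0 < a)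
    (hb : 0 < b) (hδ : 0 < δ) (hθ0 : 0 < θ) (hθ1 : θ ≤ 1)
    (hθ : θ * (25 / 2 / lam + σ⁻¹ ^ 2 / 4 + 5 / 2 * σ⁻¹) ≤ δ / 2)
    {β₀ : Fin p → ℝ} (hs : 1 ≤ sparsity β₀)
    (heig : ∀ ξ : Finset (Fin p), ξ.card ≤ m → ∀ t : ℝ, Module.End.HasEigenvalue
      (Matrix.toLin' ((columnSubmatrix X ξ)ᵀ * columnSubmatrix X ξ)) t → (n : ℝ) * lam < t)
    {y : Fin n → ℝ}
    (hy : stdResidual X σ β₀ y ∈ noiseEvent X σ β₀ θ (√(sparsity β₀ * L / n) / p) (δ * L)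
      (sparsity β₀) m (studentPrior p a b) L)
    {q : Measure (Fin p → ℝ)} [IsProbabilityMeasure q]
    (hq : negELBO X σ a b y q ≤ ((baseline X σ β₀ y + U : ℝ) : EReal))
    (hT : 0 < T) (hTm : (2 * T / δ + 1) * sparsity β₀ ≤ m)
    (hM0 : 0 < M) (hM : 2 * (σ ^ 2 * (4 * T / θ) + 1) / lam + 1 < M ^ 2) :
    q {β | M * √(sparsity β₀ * L / n) ≤ ‖WithLp.toLp 2 (β - β₀)‖}
      ≤ ENNReal.ofReal ((U + sparsity β₀ * L + δ / 2 * (sparsity β₀ * L))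
        / (T * (sparsity β₀ * L))) := by
  set s := sparsity β₀ with hsdef
  set R := √(s * L / n) with hR
  set r := R / p with hr
  have hn' : (0 : ℝ) < n := by exact_mod_cast hn
  have hp' : (0 : ℝ) < p := by exact_mod_cast hp
  have hs' : (1 : ℝ) ≤ s := by exact_mod_cast hs
  have hsL : 0 < s * L := by positivity
  have hR0 : 0 < R := Real.sqrt_pos.2 (by positivity)
  have hR2 : R ^ 2 = s * L / n := Real.sq_sqrt (by positivity)
  have hnR : n * R ^ 2 = s * L := by rw [hR2]; field_simp
  have hr0 : 0 ≤ r := by positivity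
  have hpr : p * r = R := by rw [hr]; field_simp
  obtain ⟨hcolsum, hev⟩ := hy
  set e := stdResidual X σ β₀ y with he
  have hnoise := abs_transpose_mulVec_le_of_columnExpSum hcol hn hL hcolsum
  have hoff : ∀ β : Fin p → ℝ, ∑ j ∈ (activeSet r β₀ β)ᶜ, |(β - β₀) j| ≤ R := fun β =>
    (sum_abs_compl_activeSet_le hr0 β₀ β).trans_eq hpr
  have hcard : ∀ β : Fin p → ℝ, ((activeSet r β₀ β).card : ℝ) ≤ largeCount r β + s := fun β => by
    exact_mod_cast card_activeSet_le r β₀ β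
  have hRE : ∀ β : Fin p → ℝ, largeCount r β + s ≤ m →
      n * lam * ∑ j ∈ activeSet r β₀ β, (β - β₀) j ^ 2
        ≤ 2 * ((X *ᵥ (β - β₀)) ⬝ᵥ (X *ᵥ (β - β₀)) + n * R ^ 2) := fun β hβ =>
    restricted_sum_sq_le hcol _ _ (sum_sq_le_of_eigenvalue_bound X _
      (heig _ ((card_activeSet_le r β₀ β).trans hβ)) _) (hoff β)
  set v := signal X σ β₀ with hv
  have hτR : 5 / 2 * √(n * L) * R ≤ 5 / 2 * (s * L) := by
    have h1 : √(n * L) * R = √(s * L ^ 2) := by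
      rw [hR, ← Real.sqrt_mul (by positivity)]
      congr 1
      field_simp
    -- Here `√s ≤ s`, which needs `s ≥ 1`.
    have h2 : √(s * L ^ 2) ≤ s * L := by
      rw [Real.sqrt_le_left (by positivity)]
      nlinarith [sq_nonneg L, mul_nonneg (sq_nonneg L) (sub_nonneg.2 hs')]
    rw [mul_assoc, h1]
    linarith
  have hcross : ∀ β : Fin p → ℝ, largeCount r β + s ≤ m →
      v β ⬝ᵥ e ≤ v β ⬝ᵥ v β / 4 + (25 / 2 / lam + σ⁻¹ ^ 2 / 4 + 5 / 2 * σ⁻¹)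
        * ((largeCount r β + s) * L) := fun β hβ => by
    have hSc := sparsity_le_card_activeSet r β₀ β
    refine (cross_term_le (s := s) hn hσ hlam hL.le (by positivity) (activeSet r β₀ β) (β - β₀) e
      (hRE β hβ) (hoff β) hnoise hnR.le ?_ hτR (by exact_mod_cast hSc)
      (by omega)).trans ?_
    · rw [mul_pow, Real.sq_sqrt (by positivity)]
      norm_num
    · have := hcard β
      have hσ' : 0 < σ⁻¹ := inv_pos.2 hσ
      gcongr _ + _ * (?_ * _)
  -- What survives of the integrand: half the penalty everywhere, and a share of the signal where
  -- restricted eigenvalues are available.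
  set Z : (Fin p → ℝ) → ℝ := fun β => δ / 2 * L * largeCount r β
    + if largeCount r β + s ≤ m then θ / 4 * (v β ⬝ᵥ v β) else 0 with hZdef
  have hvv : ∀ β, 0 ≤ v β ⬝ᵥ v β := fun β => dotProduct_self_nonneg_real _
  have hZ0 : ∀ β, 0 ≤ Z β := fun β => by
    have := hvv β
    simp only [hZdef]
    split_ifs <;> positivity
  have hZ : ∀ β, Z β ≤ score X σ β₀ θ r (δ * L) s m e β
      + (v β ⬝ᵥ v β / 2 - v β ⬝ᵥ e) + δ / 2 * (s * L) := fun β => by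
    have hvβ := hvv β
    have hk : (0 : ℝ) ≤ largeCount r β := Nat.cast_nonneg _
    simp only [hZdef, score, shrunkSignal]
    rw [← hv]
    by_cases hβ : largeCount r β + s ≤ m
    · rw [if_pos hβ, if_pos hβ, smul_dotProduct, smul_dotProduct, dotProduct_smul,
        smul_eq_mul, smul_eq_mul, smul_eq_mul]
      -- The shrunk and full likelihood terms sum to `θ (1 - θ / 2) |v|² - θ v · e`. The cross term
      -- takes `θ / 4` of `|v|²` and half the penalty; since `θ ≤ 1`, at least `θ / 4` of `|v|²`
      -- remains.
      have h1 := mul_le_mul_of_nonneg_left (hcross β hβ) hθ0.le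
      have h2 := mul_le_mul_of_nonneg_right hθ
        (show 0 ≤ ((largeCount r β : ℝ) + s) * L by positivity)
      have h3 : 0 ≤ θ * (1 - θ) * (v β ⬝ᵥ v β) :=
        mul_nonneg (mul_nonneg hθ0.le (by linarith)) hvβ
      nlinarith
    · rw [if_neg hβ, if_neg hβ, one_smul]
      have : 0 ≤ δ * L * largeCount r β := by positivity
      have : 0 ≤ δ * (s * L) := by positivity
      linarith
  have hmain := measure_ge_le_of_negELBO_le hσ ha hb hθ0.le hθ1 hq hev hZ0 hZ
    (T := T * (s * L)) (by positivity)
  refine (measure_mono fun β hβ => ?_).trans hmain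
  by_contra hcon
  have hZlt : Z β < T * (s * L) := not_le.1 hcon
  have hvβ := hvv β
  -- The penalty part of `Z` alone forces few large coordinates, which places `β` in the regime
  -- where `Z` also sees the signal.
  have hklt : (largeCount r β : ℝ) + s ≤ (2 * T / δ + 1) * s := by
    have h1 : δ / 2 * L * largeCount r β ≤ Z β := by
      simp only [hZdef]
      split_ifs
      · have : 0 ≤ θ / 4 * (v β ⬝ᵥ v β) := by positivity
        linarith
      · linarith
    have h2 : (largeCount r β : ℝ) ≤ 2 * T / δ * s := by
      have h3 : δ / 2 * L * largeCount r β ≤ δ / 2 * L * (2 * T / δ * s) := by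
        calc _ ≤ T * (s * L) := h1.trans hZlt.le
          _ = _ := by field_simp
      exact le_of_mul_le_mul_left h3 (by positivity)
    linarith
  have hgood : largeCount r β + s ≤ m := by exact_mod_cast hklt.trans hTm
  have hvlt : v β ⬝ᵥ v β ≤ 4 * T / θ * (s * L) := by
    have h1 : θ / 4 * (v β ⬝ᵥ v β) ≤ Z β := by
      simp only [hZdef, if_pos hgood]
      have : 0 ≤ δ / 2 * L * largeCount r β := by positivity
      linarith
    have h3 : θ / 4 * (v β ⬝ᵥ v β) ≤ θ / 4 * (4 * T / θ * (s * L)) := by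
      calc _ ≤ T * (s * L) := h1.trans hZlt.le
        _ = _ := by field_simp
    exact le_of_mul_le_mul_left h3 (by positivity)
  have hXΔ : (X *ᵥ (β - β₀)) ⬝ᵥ (X *ᵥ (β - β₀)) = σ ^ 2 * (v β ⬝ᵥ v β) := by
    rw [hv, signal, smul_dotProduct, dotProduct_smul, smul_eq_mul, smul_eq_mul]
    field_simp
  have hon := hRE β hgood
  rw [hXΔ, hnR] at hon
  have hoff2 : ∑ j ∈ (activeSet r β₀ β)ᶜ, (β - β₀) j ^ 2 ≤ R ^ 2 := by
    calc ∑ j ∈ (activeSet r β₀ β)ᶜ, (β - β₀) j ^ 2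
        = ∑ j ∈ (activeSet r β₀ β)ᶜ, |(β - β₀) j| ^ 2 := by simp_rw [sq_abs]
      _ ≤ (∑ j ∈ (activeSet r β₀ β)ᶜ, |(β - β₀) j|) ^ 2 :=
          Finset.sum_sq_le_sq_sum_of_nonneg fun _ _ => abs_nonneg _
      _ ≤ R ^ 2 := by
          have := hoff β
          have : 0 ≤ ∑ j ∈ (activeSet r β₀ β)ᶜ, |(β - β₀) j| :=
            Finset.sum_nonneg fun _ _ => abs_nonneg _
          gcongr
  have honR : ∑ j ∈ activeSet r β₀ β, (β - β₀) j ^ 2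
      ≤ 2 * (σ ^ 2 * (4 * T / θ) + 1) / lam * R ^ 2 := by
    have h1 : n * lam * ∑ j ∈ activeSet r β₀ β, (β - β₀) j ^ 2
        ≤ n * lam * (2 * (σ ^ 2 * (4 * T / θ) + 1) / lam * R ^ 2) := by
      calc _ ≤ 2 * (σ ^ 2 * (4 * T / θ * (s * L)) + s * L) := by
            refine hon.trans ?_
            gcongr
        _ = 2 * (σ ^ 2 * (4 * T / θ) + 1) * (n * R ^ 2) := by rw [hnR]; ring
        _ = _ := by field_simp
    exact le_of_mul_le_mul_left h1 (by positivity)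
  have hnorm : ‖WithLp.toLp 2 (β - β₀)‖ ^ 2 < (M * R) ^ 2 := by
    rw [EuclideanSpace.real_norm_sq_eq]
    calc ∑ j, (WithLp.toLp 2 (β - β₀)) j ^ 2
        = ∑ j ∈ activeSet r β₀ β, (β - β₀) j ^ 2 + ∑ j ∈ (activeSet r β₀ β)ᶜ, (β - β₀) j ^ 2 :=
          (Finset.sum_add_sum_compl _ _).symm
      _ ≤ (2 * (σ ^ 2 * (4 * T / θ) + 1) / lam + 1) * R ^ 2 := by linarith
      _ < M ^ 2 * R ^ 2 := by gcongr
      _ = _ := by ring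
  have hlt := lt_of_pow_lt_pow_left₀ 2 (by positivity) hnorm
  exact absurd (show M * R ≤ ‖WithLp.toLp 2 (β - β₀)‖ from hβ) (not_le.2 hlt)

/-! ### Transfer to the data law and consequences of the prior scale bounds. -/

theorem dataLaw_preimage_stdResidual {n p : ℕ} (X : Matrix (Fin n) (Fin p) ℝ) {σ : ℝ} (hσ : 0 < σ)
    (β₀ : Fin p → ℝ) {A : Set (Fin n → ℝ)} (hA : MeasurableSet A) :
    dataLaw X σ β₀ (stdResidual X σ β₀ ⁻¹' A)
      = (Measure.pi fun _ : Fin n => gaussianReal 0 1) A := by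
  rw [dataLaw, Measure.map_apply (by fun_prop) (measurable_stdResidual X σ β₀ hA)]
  congr 1
  ext ε
  have : stdResidual X σ β₀ (X *ᵥ β₀ + σ • ε) = ε := by
    rw [stdResidual, add_sub_cancel_left, smul_smul, inv_mul_cancel₀ hσ.ne', one_smul]
  simp [this]

theorem mul_le_of_rate_bound {n p s : ℕ} {a b δ L : ℝ} (hn : 0 < n) (hp : 0 < p)
    (ha : 1 < a)
    (h : b / a ≤ 1 / (4 * a) * (s * L /
      (n * (p : ℝ) ^ (2 + 1 / a) * Real.exp (δ * L / a)))) :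
    4 * b * (n * p ^ 2) * ((p : ℝ) ^ (1 / a) * Real.exp (δ * L / a)) ≤ s * L := by
  have ha0 : 0 < a := by linarith
  have hn' : (0 : ℝ) < n := by exact_mod_cast hn
  have hp' : (0 : ℝ) < p := by exact_mod_cast hp
  have hpow : (p : ℝ) ^ (2 + 1 / a) = (p : ℝ) ^ 2 * (p : ℝ) ^ (1 / a) := by
    rw [Real.rpow_add hp', Real.rpow_two]
  rw [hpow] at h
  have hP : 0 < (p : ℝ) ^ (1 / a) := by positivity
  have hE := Real.exp_pos (δ * L / a)
  set P := (p : ℝ) ^ (1 / a)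
  set E := Real.exp (δ * L / a)
  have h2 := mul_le_mul_of_nonneg_left h
    (show 0 ≤ 4 * a * (n * (p ^ 2 * P) * E) by positivity)
  have e1 : 4 * a * (n * (p ^ 2 * P) * E) * (b / a) = 4 * b * (n * p ^ 2) * (P * E) := by
    field_simp
  have e2 : 4 * a * (n * (p ^ 2 * P) * E) * (1 / (4 * a) * (s * L / (n * (p ^ 2 * P) * E)))
      = s * L := by
    field_simp
  linarith

/-- The prior puts mass at most `p⁻¹ (p ∨ n)^(-δ)` outside a ball of radius `rate / p`. -/
theorem studentT_tail_le_of_rate_bound {n p s : ℕ} {a b δ L : ℝ} (hn : 0 < n) (hp : 0 < p)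
    (hs : 0 < s) (hL : 0 < L) (ha : 1 < a) (hb : 0 < b)
    (h : b / a ≤ 1 / (4 * a) * (s * L /
      (n * (p : ℝ) ^ (2 + 1 / a) * Real.exp (δ * L / a)))) :
    studentT 0 a b {x | √(s * L / n) / p < |x|} ≤ ENNReal.ofReal (Real.exp (-(δ * L)) / p) := by
  have ha0 : 0 < a := by linarith
  have hn' : (0 : ℝ) < n := by exact_mod_cast hn
  have hp' : (0 : ℝ) < p := by exact_mod_cast hp
  have hs' : (0 : ℝ) < s := by exact_mod_cast hs
  have hr : 0 < √(s * L / n) / p := div_pos (Real.sqrt_pos.2 (by positivity)) hp'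
  refine (studentT_tail_le ha0 hb hr).trans (ENNReal.ofReal_le_ofReal ?_)
  have hmul := mul_le_of_rate_bound hn hp ha h
  set Q := (p : ℝ) ^ (1 / a) * Real.exp (δ * L / a) with hQ
  have hQ0 : 0 < Q := by positivity
  have hQa : Q ^ a = p * Real.exp (δ * L) := by
    rw [hQ, Real.mul_rpow (by positivity) (by positivity), ← Real.rpow_mul hp'.le, ← Real.exp_mul,
      one_div_mul_cancel ha0.ne', Real.rpow_one, div_mul_cancel₀ _ ha0.ne']
  -- The `p²` in the rate condition absorbs the radius `rate / p`, and the `a`-th power turns `p ^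
  -- (1/a) exp (δ L / a)` into `p exp (δ L)`. The constant `1 / 4` leaves `1 / 2` here, whose `a`-th
  -- power cancels the factor `2` of the tail bound.
  have h1 : 2 * b / (√(s * L / n) / p) ^ 2 ≤ 1 / 2 * Q⁻¹ := by
    rw [div_pow, Real.sq_sqrt (by positivity), div_le_iff₀ (by positivity)]
    have e : 1 / 2 * Q⁻¹ * (s * L / n / p ^ 2) = (s * L) / (2 * Q * (n * p ^ 2)) := by
      field_simp
    rw [e, le_div_iff₀ (by positivity)]
    linarith
  have h2 : (2 * b / (√(s * L / n) / p) ^ 2) ^ a ≤ (1 / 2 * Q⁻¹) ^ a :=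
    Real.rpow_le_rpow (by positivity) h1 ha0.le
  have h3 : (1 / 2 * Q⁻¹) ^ a ≤ 1 / 2 * (Q ^ a)⁻¹ := by
    rw [Real.mul_rpow (by norm_num) (by positivity), Real.inv_rpow hQ0.le]
    have h4 : (1 / 2 : ℝ) ^ a ≤ (1 / 2 : ℝ) ^ (1 : ℝ) :=
      Real.rpow_le_rpow_of_exponent_ge (by norm_num) (by norm_num) ha.le
    rw [Real.rpow_one] at h4
    gcongr
  calc 2 * (2 * b / (√(s * L / n) / p) ^ 2) ^ a ≤ 2 * (1 / 2 * (Q ^ a)⁻¹) := by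
        gcongr
        exact h2.trans h3
    _ = Real.exp (-(δ * L)) / p := by
        rw [hQa, Real.exp_neg]
        field_simp

/-- The left side is, up to a constant, the expected cost of the quadratic bound in
`signal_sub_cross_le` under the shifted prior. -/
theorem prior_variance_le_of_rate_bound {n p s : ℕ} {a b δ L : ℝ} (hn : 0 < n) (hp : 0 < p)
    (hL : 0 < L) (ha : 1 < a) (hb : 0 < b) (hδ : 0 < δ)
    (h : b / a ≤ 1 / (4 * a) * (s * L /
      (n * (p : ℝ) ^ (2 + 1 / a) * Real.exp (δ * L / a)))) :
    (n * p : ℝ) * (p * (b / (a - 1))) ≤ 1 / (4 * (a - 1)) * (s * L) := by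
  have ha0 : 0 < a := by linarith
  have ha1 : 0 < a - 1 := by linarith
  have hp' : (1 : ℝ) ≤ p := by exact_mod_cast hp
  have hmul := mul_le_of_rate_bound hn hp ha h
  have h1 : 1 ≤ (p : ℝ) ^ (1 / a) * Real.exp (δ * L / a) := by
    have h2 : 1 ≤ (p : ℝ) ^ (1 / a) := Real.one_le_rpow hp' (by positivity)
    have h3 : 1 ≤ Real.exp (δ * L / a) := Real.one_le_exp (by positivity)
    nlinarith
  have h4 : 4 * b * (n * p ^ 2) ≤ s * L :=
    (le_mul_of_one_le_right (by positivity) h1).trans hmul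
  calc (n * p : ℝ) * (p * (b / (a - 1))) = 1 / (4 * (a - 1)) * (4 * b * (n * p ^ 2)) := by
        field_simp
    _ ≤ _ := by gcongr

/-- The logarithmic price of shifting a prior coordinate to the true coefficient. -/
theorem log_two_add_sq_div_le {C K L b x : ℝ} (hL : 1 ≤ L) (hx : x ≠ 0)
    (hxC : Real.log |x| ≤ C * L) (hb : Real.exp (-K * L) ≤ b) :
    Real.log (2 + x ^ 2 / b) ≤ (2 + 2 * |C| + |K|) * L := by
  have hb0 : 0 < b := (Real.exp_pos _).trans_le hb
  have hL0 : 0 ≤ L := by linarith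
  set A := (2 * |C| + |K|) * L with hA
  have hA0 : 0 ≤ A := by positivity
  have h1 : x ^ 2 ≤ Real.exp (2 * |C| * L) := by
    rw [← sq_abs, ← Real.log_le_iff_le_exp (by positivity), Real.log_pow]
    have : C * L ≤ |C| * L := by gcongr; exact le_abs_self C
    push_cast
    linarith
  have h2 : x ^ 2 / b ≤ Real.exp A := by
    rw [div_le_iff₀ hb0]
    calc x ^ 2 ≤ Real.exp (2 * |C| * L) := h1
      _ ≤ Real.exp A * Real.exp (-K * L) := by
          rw [← Real.exp_add]
          refine Real.exp_le_exp.2 ?_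
          have : K * L ≤ |K| * L := by gcongr; exact le_abs_self K
          rw [hA]
          linarith
      _ ≤ _ := by gcongr
  have h3 : 2 + x ^ 2 / b ≤ Real.exp ((2 + 2 * |C| + |K|) * L) := by
    have e1 : Real.exp ((2 + 2 * |C| + |K|) * L) = Real.exp (2 * L) * Real.exp A := by
      rw [← Real.exp_add, hA]; ring_nf
    have e2 : 3 ≤ Real.exp (2 * L) := by
      -- As `L ≥ 1`, the factor `exp (2 L)` absorbs the additive `2`.
      have := Real.add_one_le_exp (2 * L)
      linarith
    have e3 : 1 ≤ Real.exp A := Real.one_le_exp hA0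
    rw [e1]
    nlinarith
  exact (Real.log_le_iff_le_exp (by positivity)).2 h3

/-! ### Asymptotics: assembling the theorem. -/

theorem theorem2
    -- dimension, design, true coefficient vector and known noise level
    (p : ℕ → ℕ) (X : ∀ n : ℕ, Matrix (Fin n) (Fin (p n)) ℝ) (β₀ : ∀ n : ℕ, Fin (p n) → ℝ)
    (σ : ℝ) (hσ : 0 < σ)
    -- the columns of the design have squared norm at most `n`
    (hcol : ∀ᶠ n : ℕ in atTop, ∀ j : Fin (p n), ∑ i : Fin n, X n i j ^ 2 ≤ (n : ℝ))
    -- restricted eigenvalues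
    (pbar : ℕ → ℕ) (lam₀ : ℝ) (hlam₀ : 0 < lam₀)
    (hpbar : (fun n : ℕ => (sparsity (β₀ n) : ℝ)) =o[atTop] fun n : ℕ => (pbar n : ℝ))
    (heig : ∀ᶠ n : ℕ in atTop, ∀ ξ : Finset (Fin (p n)), ξ.card ≤ pbar n →
      ∀ t : ℝ, Module.End.HasEigenvalue
        (Matrix.toLin' ((columnSubmatrix (X n) ξ)ᵀ * columnSubmatrix (X n) ξ)) t →
        (n : ℝ) * lam₀ < t)
    -- at most polynomial growth of the true coefficients
    (hβ₀ : ∃ C : ℝ, ∀ᶠ n : ℕ in atTop, ∀ j : Fin (p n),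
      Real.log |β₀ n j| ≤ C * logMax (p n) n)
    -- the prior hyperparameters
    (a₀ : ℝ) (ha₀ : 1 < a₀) (b : ℕ → ℝ) (hb : ∀ n : ℕ, 0 < b n)
    (K δ : ℝ) (hδ : 0 < δ)
    (hb_lower : (fun n : ℕ => ((max (p n) n : ℕ) : ℝ) ^ (-K)) =o[atTop] fun n : ℕ => b n / a₀)
    (hb_upper : (fun n : ℕ => b n / a₀) =o[atTop] fun n : ℕ =>
      (sparsity (β₀ n) : ℝ) * logMax (p n) n /
        ((n : ℝ) * (p n : ℝ) ^ (2 + 1 / a₀) * ((max (p n) n : ℕ) : ℝ) ^ (δ / a₀)))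
    -- admissible optimisation slack; `κ = 0` means exact minimisers of the negative ELBO
    (κ : ℝ) (hκ : 0 ≤ κ) :
    -- events of probability tending to one, on which the contraction holds for every `M`
    ∃ E : ∀ n : ℕ, Set (Fin n → ℝ),
      (∀ n : ℕ, MeasurableSet (E n)) ∧
      Tendsto (fun n : ℕ => dataLaw (X n) σ (β₀ n) (E n)) atTop (𝓝 1) ∧
      ∀ M : ℕ → ℝ, Tendsto M atTop atTop →
        ∀ ε : ℝ, 0 < ε → ∀ᶠ n : ℕ in atTop, ∀ y ∈ E n, ∀ q : Measure (Fin (p n) → ℝ),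
          IsVariationalPosterior (X n) σ a₀ (b n) y
            (κ * ((sparsity (β₀ n) : ℝ) * logMax (p n) n)) q →
          q {β : Fin (p n) → ℝ |
              M n * contractionRate (sparsity (β₀ n)) (p n) n
                ≤ ‖WithLp.toLp 2 (β - β₀ n)‖} ≤ ENNReal.ofReal ε := by
  obtain ⟨C, hC⟩ := hβ₀
  have ha : 0 < a₀ := by linarith
  have ha1 : 0 < a₀ - 1 := by linarith
  have hσ' : 0 < σ⁻¹ := inv_pos.2 hσ
  -- the shrinkage factor
  set C₁ := 25 / 2 / lam₀ + σ⁻¹ ^ 2 / 4 + 5 / 2 * σ⁻¹ with hC₁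
  have hC₁0 : 0 < C₁ := by positivity
  set θ := min 1 (δ / (2 * C₁)) with hθ
  have hθ0 : 0 < θ := lt_min one_pos (by positivity)
  have hθ1 : θ ≤ 1 := min_le_left _ _
  have hθC : θ * C₁ ≤ δ / 2 := by
    calc θ * C₁ ≤ δ / (2 * C₁) * C₁ := by gcongr; exact min_le_right _ _
      _ = δ / 2 := by field_simp
  -- elementary facts for large `n`
  have hbasic : ∀ᶠ n : ℕ in atTop, 0 < n ∧ 1 ≤ logMax (p n) n ∧
      ((max (p n) n : ℕ) : ℝ) = Real.exp (logMax (p n) n) := by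
    filter_upwards [eventually_ge_atTop 3] with n hn
    have h3 : (3 : ℝ) ≤ ((max (p n) n : ℕ) : ℝ) := by
      exact_mod_cast hn.trans (le_max_right _ _)
    have hpos : (0 : ℝ) < ((max (p n) n : ℕ) : ℝ) := by linarith
    refine ⟨by omega, ?_, (Real.exp_log hpos).symm⟩
    rw [logMax, Real.le_log_iff_exp_le hpos]
    have := Real.exp_one_lt_d9
    linarith
  have hhyper : ∀ᶠ n : ℕ in atTop, 1 ≤ sparsity (β₀ n) ∧ 0 < p n ∧
      b n / a₀ ≤ 1 / (4 * a₀) * (sparsity (β₀ n) * logMax (p n) n /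
        (n * (p n : ℝ) ^ (2 + 1 / a₀) * Real.exp (δ * logMax (p n) n / a₀))) := by
    filter_upwards [hb_upper.bound (show 0 < 1 / (4 * a₀) by positivity), hbasic]
      with n hn ⟨hn0, hL, hexp⟩
    have hbn : 0 < b n / a₀ := div_pos (hb n) ha
    have hpowexp : ((max (p n) n : ℕ) : ℝ) ^ (δ / a₀) = Real.exp (δ * logMax (p n) n / a₀) := by
      rw [hexp, ← Real.exp_mul]; ring_nf
    rw [Real.norm_of_nonneg hbn.le, Real.norm_of_nonneg (by positivity), hpowexp] at hn
    refine ⟨?_, ?_, hn⟩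
    -- With `s = 0` or `p = 0` the upper rate is zero (for `p = 0` through division by zero),
    -- contradicting `b n > 0`; so both are positive for large `n`.
    · by_contra h0
      have : sparsity (β₀ n) = 0 := by omega
      simp only [this, Nat.cast_zero, zero_mul, zero_div, mul_zero] at hn
      linarith
    · by_contra h0
      have hp0 : p n = 0 := by omega
      have hz : ((p n : ℕ) : ℝ) ^ (2 + 1 / a₀) = 0 := by
        rw [hp0, Nat.cast_zero]
        exact Real.zero_rpow (by positivity)
      simp only [hz, mul_zero, zero_mul, div_zero] at hn
      linarith
  have hblow : ∀ᶠ n : ℕ in atTop, Real.exp (-K * logMax (p n) n) ≤ b n := by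
    filter_upwards [hb_lower.bound one_pos, hbasic] with n hn ⟨_, _, hexp⟩
    have hbn : 0 < b n / a₀ := div_pos (hb n) ha
    rw [Real.norm_of_nonneg hbn.le, Real.norm_of_nonneg (by positivity), one_mul, hexp,
      ← Real.exp_mul, mul_comm] at hn
    exact hn.trans (div_le_self (hb n).le ha₀.le)
  have hprior : ∀ n, IsProbabilityMeasure (studentPrior (p n) a₀ (b n)) := fun n => by
    have : Fact (0 < a₀) := ⟨ha⟩
    have : Fact (0 < b n) := ⟨hb n⟩
    infer_instance
  set A : ∀ n : ℕ, Set (Fin n → ℝ) := fun n => noiseEvent (X n) σ (β₀ n) θ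
    (√(sparsity (β₀ n) * logMax (p n) n / n) / p n) (δ * logMax (p n) n) (sparsity (β₀ n))
    (pbar n) (studentPrior (p n) a₀ (b n)) (logMax (p n) n) with hA
  have hAm : ∀ n, MeasurableSet (A n) := fun n => measurableSet_noiseEvent _ _ _ _ _ _ _ _ _ _
  refine ⟨fun n => stdResidual (X n) σ (β₀ n) ⁻¹' A n,
    fun n => measurable_stdResidual _ _ _ (hAm n), ?_, ?_⟩
  · -- the events have probability tending to one
    simp_rw [fun n => dataLaw_preimage_stdResidual (X n) hσ (β₀ n) (hAm n)]
    have hlim : Tendsto (fun n : ℕ => 1 - ENNReal.ofReal ((2 + Real.exp 1) * (n : ℝ)⁻¹))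
        atTop (𝓝 1) := by
      have h1 : Tendsto (fun n : ℕ => (2 + Real.exp 1) * (n : ℝ)⁻¹) atTop (𝓝 0) := by
        simpa using (tendsto_inv_atTop_nhds_zero_nat (𝕜 := ℝ)).const_mul (2 + Real.exp 1)
      have h2 := ENNReal.Tendsto.sub (tendsto_const_nhds (x := (1 : ℝ≥0∞)) (f := atTop))
        (ENNReal.tendsto_ofReal h1) (Or.inl ENNReal.one_ne_top)
      simpa using h2
    refine tendsto_of_tendsto_of_tendsto_of_le_of_le' hlim tendsto_const_nhds ?_
      (Eventually.of_forall fun n => prob_le_one)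
    filter_upwards [hbasic, hhyper] with n ⟨hn0, hL, hexp⟩ ⟨hs, hp, hup⟩
    have hc := measure_compl_noiseEvent_le (X n) σ (β₀ n) θ (pbar n) hp ha (hb n) hs
      (L := logMax (p n) n) (by linarith) (by rw [← hexp]; exact_mod_cast le_max_left _ _)
      (studentT_tail_le_of_rate_bound hn0 hp (by omega) (by linarith) ha₀ (hb n) hup)
    have hexpn : Real.exp (-logMax (p n) n) ≤ (n : ℝ)⁻¹ := by
      rw [Real.exp_neg, ← hexp]
      have : (0 : ℝ) < n := by exact_mod_cast hn0
      gcongr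
      exact le_max_right _ _
    have hle := hc.trans (ENNReal.ofReal_le_ofReal
      (mul_le_mul_of_nonneg_left hexpn (show 0 ≤ 2 + Real.exp 1 by positivity)))
    rw [prob_compl_eq_one_sub (hAm n)] at hle
    exact tsub_le_iff_tsub_le.1 hle
  · intro M hM ε hε
    set CU := (σ⁻¹ ^ 2 / 2 + σ⁻¹ / 2) * (1 / (4 * (a₀ - 1))) + 25 / 8 * σ⁻¹
      + (a₀ + 1 / 2) * (2 + 2 * |C| + |K|) + κ with hCU
    have hCU0 : 0 < CU := by positivity
    -- Chosen so that the final Markov ratio equals `ε` exactly.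
    set T := (CU + 1 + δ / 2) / ε with hT
    have hT0 : 0 < T := by positivity
    filter_upwards [hcol, heig, hC, hbasic, hhyper, hblow,
      hpbar.bound (show 0 < (2 * T / δ + 1)⁻¹ by positivity),
      hM.eventually_gt_atTop (2 * (σ ^ 2 * (4 * T / θ) + 1) / lam₀ + 1)]
      with n hcoln heign hCn ⟨hn0, hL, hexp⟩ ⟨hs, hp, hup⟩ hlow hpb hMn y hy q hq
    set L := logMax (p n) n with hLdef
    set s := sparsity (β₀ n) with hsdef
    have hL0 : 0 < L := by linarith
    have hs' : (1 : ℝ) ≤ s := by exact_mod_cast hs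
    have hsL : 0 < s * L := by positivity
    have hLsL : L ≤ s * L := le_mul_of_one_le_left hL0.le hs'
    have hqp := isProbabilityMeasure_of_mem_variationalFamily hq.1
    have hnoise := abs_transpose_mulVec_le_of_columnExpSum hcoln hn0 hL0 hy.1
    have hstar := negELBO_shifted_studentPrior_le hcoln hn0 hσ ha₀ (hb n) (β₀ n) y hnoise
      (L := L) (D := (a₀ + 1 / 2) * ((2 + 2 * |C| + |K|) * L))
      (by rw [mul_pow, Real.sq_sqrt (by positivity)]; norm_num) (by positivity)
      (fun j hj => mul_le_mul_of_nonneg_left (log_two_add_sq_div_le hL hj (hCn j) hlow)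
        (by positivity))
    have hU : negELBO (X n) σ a₀ (b n) y q
        ≤ ((baseline (X n) σ (β₀ n) y + CU * (s * L) : ℝ) : EReal) := by
      refine (hq.2 _ ⟨β₀ n, fun _ => a₀, fun _ => b n, fun _ => ha, fun _ => hb n, rfl⟩).trans
        ((add_le_add hstar le_rfl).trans ?_)
      rw [← EReal.coe_add, EReal.coe_le_coe_iff, hCU]
      have h1 := mul_le_mul_of_nonneg_left
        (prior_variance_le_of_rate_bound hn0 hp hL0 ha₀ (hb n) hδ hup)
        (show 0 ≤ σ⁻¹ ^ 2 / 2 + σ⁻¹ / 2 by positivity)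
      have h2 := mul_le_mul_of_nonneg_left hLsL (show 0 ≤ 25 / 8 * σ⁻¹ by positivity)
      linarith
    have hTm : (2 * T / δ + 1) * s ≤ pbar n := by
      rw [Real.norm_natCast, Real.norm_natCast] at hpb
      calc (2 * T / δ + 1) * s ≤ (2 * T / δ + 1) * ((2 * T / δ + 1)⁻¹ * pbar n) := by gcongr
        _ = pbar n := by rw [← mul_assoc, mul_inv_cancel₀ (by positivity), one_mul]
    have hc0 : 0 ≤ 2 * (σ ^ 2 * (4 * T / θ) + 1) / lam₀ := by positivity
    -- `M n` exceeds a constant that is at least `1`, so its square exceeds that constant too.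
    have hfin := measure_norm_ge_le hcoln hn0 hp hσ hlam₀ hL0 ha (hb n) hδ hθ0 hθ1 hθC hs heign
      hy hU hT0 hTm (M := M n) (by linarith) (by nlinarith)
    refine hfin.trans (ENNReal.ofReal_le_ofReal (le_of_eq ?_))
    have e : T * (sparsity (β₀ n) * L) = (CU * (s * L) + s * L + δ / 2 * (s * L)) / ε := by
      rw [hT, ← hsdef]
      ring
    rw [e]
    exact div_div_cancel₀ (by positivity)
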